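/- All posets are finite. Let $P$ be a finite graded poset with a least element $\hat 0$, a greatest element $\hat 1$ and rank function $\rho$ (so $\rho(\hat 0)=0$); an interval $[x,y]$ with $\rho(y)-\rho(x)=n$ is called an $n$-interval, and the rank of $P$ is $\rho(\hat 1)$. $P$ is \emph{Eulerian} if every interval $[x,y]$ with $x<y$ contains as many elements of even rank as of odd rank. $P$ is a \emph{Sheffer poset} if for every $n$ all $n$-intervals $[\hat 0,y]$ have the same number $D(n)$ of maximal chains and all $n$-intervals $[x,y]$ with $x\neq\hat 0$ have the same number $B(n)$ of maximal chains. $B_n$ denotes the boolean lattice of subsets of an $n$-element set. For a poset $Q$ with a least element $\hat 0$, the dual suspension $\Sigma^{*}(Q)$ is $Q$ together with two new incomparable elements $a_1,a_2$ satisfying $\hat 0<a_i<y$ for all $y>\hat 0$ in $Q$. For a poset $Q$ with $\hat 0\ne\hat 1$ and a positive integer $\alpha$, the $\alpha$-summation $\boxplus^{\alpha}(Q)$ is the poset obtained from $\alpha$ disjoint copies of $Q$ by identifying all their least elements and identifying all their greatest elements. \textbf{Theorem.} Let $P$ be an Eulerian Sheffer poset of odd rank $2m+1\ge 5$ with $B(3)=6$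 and $D(3)=4$. Then there is an integer $\alpha\ge 1$ such that $P$ is isomorphic to $\boxplus^{\alpha}(\Sigma^{*}(B_{2m}))$. -/

import Mathlib

namespace EulerianSheffer

/-! Finite posets with a least element, a greatest element and a rank function.
Gradedness is Mathlib's `GradeMinOrder ℕ P`: the rank function `grade ℕ` is strictly monotone,
increases by exactly one along covers, and vanishes at the least element. -/

section Poset

variable (P : Type*) [PartialOrder P] [BoundedOrder P] [GradeMinOrder ℕ P]

/-- A graded poset is Eulerian if every non-singleton interval has as many elements of even rank
as of odd rank. (Measuring ranks in `P` instead of in the interval at most swaps the two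
classes.) -/
def IsEulerian : Prop :=
  ∀ x y : P, x < y →
    {z ∈ Set.Icc x y | Even (grade ℕ z)}.ncard = {z ∈ Set.Icc x y | Odd (grade ℕ z)}.ncard

variable {P} in
/-- The number of maximal chains of the interval `[x, y]`. -/
noncomputable def numMaxChains (x y : P) : ℕ := Nat.card (Flag (Set.Icc x y))

/-- A Sheffer poset: any two `n`-intervals `[⊥, y]`, `[⊥, v]` have the same number of maximal
chains, and any two `n`-intervals `[x, y]`, `[u, v]` with `x ≠ ⊥`, `u ≠ ⊥` have the same number
of maximal chains. -/
structure IsSheffer : Prop where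
  sheffer_interval : ∀ (n : ℕ) (y v : P), grade ℕ y = n → grade ℕ v = n →
    numMaxChains ⊥ y = numMaxChains ⊥ v
  binomial_interval : ∀ (n : ℕ) (x y u v : P), x ≠ ⊥ → u ≠ ⊥ → x ≤ y → u ≤ v →
    grade ℕ y = grade ℕ x + n → grade ℕ v = grade ℕ u + n →
    numMaxChains x y = numMaxChains u v

/-- `B` is the binomial factorial function of `P`: every `n`-interval `[x, y]` with `x ≠ ⊥` has
`B n` maximal chains. -/
def IsBinomialFactorialFunction (B : ℕ → ℕ) : Prop :=
  ∀ (n : ℕ) (x y : P), x ≠ ⊥ → x ≤ y → grade ℕ y = grade ℕ x + n → numMaxChains x y = B n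

/-- `D` is the Sheffer factorial function of `P`: every `n`-interval `[⊥, y]` has
`D n` maximal chains. -/
def IsShefferFactorialFunction (D : ℕ → ℕ) : Prop :=
  ∀ (n : ℕ) (y : P), grade ℕ y = n → numMaxChains ⊥ y = D n

end Poset

/-- The dual suspension `Σ*(P)` of a poset `P` with least element: the elements of `P` together
with two new elements. -/
inductive DualSuspension (P : Type*) : Type _
  | of (x : P) : DualSuspension P
  | new (i : Fin 2) : DualSuspension P

namespace DualSuspension

variable {P : Type*} [PartialOrder P] [OrderBot P]

/-- The order of `Σ*(P)`: the order of `P` on old elements; the two new elements are incomparable,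
lie above `⊥` and lie below every other old element. -/
protected def le : DualSuspension P → DualSuspension P → Prop
  | of x, of y => x ≤ y
  | of x, new _ => x = ⊥
  | new _, of y => ⊥ < y
  | new i, new j => i = j

instance : PartialOrder (DualSuspension P) where
  le := DualSuspension.le
  le_refl a := by cases a <;> simp [DualSuspension.le]
  le_trans a b c := by
    cases a <;> cases b <;> cases c <;> simp only [DualSuspension.le]
    · exact le_trans
    · rintro h rfl
      exact le_bot_iff.mp h
    · rintro rfl -
      exact bot_le
    · rintro h rfl
      exact h
    · exact lt_of_lt_of_le
    · rintro h rfl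
      exact absurd h (lt_irrefl _)
    · rintro rfl h
      exact h
    · exact Eq.trans
  le_antisymm a b := by
    cases a <;> cases b <;> simp only [DualSuspension.le]
    · intro h h'
      rw [le_antisymm h h']
    · rintro rfl h
      exact absurd h (lt_irrefl _)
    · rintro h rfl
      exact absurd h (lt_irrefl _)
    · rintro rfl -
      rfl

end DualSuspension

/-- The `k`-summation `⊞^k(P)` of a poset `P` with least element `0̂`, greatest element `1̂ ≠ 0̂`:
`k` copies of `P` with all least elements identified and all greatest elements identified.
Its elements are a common bottom, a common top, and the disjoint union (with no relations between
different copies) of `k` copies of `P \ {0̂, 1̂}`; in such a `P` the elements different from `0̂`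
and `1̂` are those that are neither minimal nor maximal. -/
abbrev KSummation (k : ℕ) (P : Type*) [PartialOrder P] : Type _ :=
  WithBot (WithTop (Σ _ : Fin k, {x : P // ¬ IsMin x ∧ ¬ IsMax x}))

/-- The boolean lattice of rank `n`: subsets of an `n`-element set ordered by inclusion. -/
abbrev BooleanLattice (n : ℕ) : Type := Finset (Fin n)

end EulerianSheffer

set_option linter.unusedSectionVars false

/-! Everything is read off from atom counts. Since $P$ is Sheffer, an interval's rank and whether it
starts at $\hat 0$ determine its number of atoms; Eulerian 2-intervals have 2 atoms, $B(3)=6$ means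
3 atoms in upper 3-intervals, and $D(3)=4$ means 2 atoms below each element of rank 3.

Upper intervals: if upper $j$-intervals have $j$ atoms for all $j\le n$, where $n\ge 3$, then
"having a common upper cover" partitions the atoms of an upper $(n+1)$-interval into classes of size
$n+1$ (`dvd_card_layer_one`), so their number is $\alpha(n+1)$. For even $n$, the Euler relation of
an interval of rank $n+2$ then forces $\alpha=1$ and $n+2$ atoms (`IsEulerian.atomCount_of_even`).
Hence $[p,\hat 1]$ is boolean for every atom $p$ (`nonempty_orderIso_finset`).

Lower intervals: elements of rank 2 over a common atom have the same two atoms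
(`atoms_eq_of_grade_two`), so atom numbers are even, and the same Euler argument gives exactly 2
atoms below every proper element of rank at least 2 (`IsEulerian.card_atoms_of_even`). The proper
part of $P$ therefore splits according to pairs of atoms, and each piece is the proper part of a
dual suspension of $B_{2m}$ (`exists_component`). -/

namespace EulerianSheffer

/-! ### Maximal chains of intervals. -/

section Chains

variable {P : Type*} [PartialOrder P]

/-- `C` is a maximal chain of the interval `[x, y]`, as a set of elements of the ambient poset. -/
structure IsMaxChainIcc (x y : P) (C : Set P) : Prop where
  subset : C ⊆ Set.Icc x y
  chain : ∀ a ∈ C, ∀ b ∈ C, a ≤ b ∨ b ≤ a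
  max : ∀ z ∈ Set.Icc x y, (∀ c ∈ C, z ≤ c ∨ c ≤ z) → z ∈ C

theorem IsMaxChainIcc.left_mem {x y : P} {C : Set P} (h : IsMaxChainIcc x y C) (hxy : x ≤ y) :
    x ∈ C :=
  h.max x ⟨le_rfl, hxy⟩ fun _ hc => Or.inl (h.subset hc).1

theorem IsMaxChainIcc.right_mem {x y : P} {C : Set P} (h : IsMaxChainIcc x y C) (hxy : x ≤ y) :
    y ∈ C :=
  h.max y ⟨hxy, le_rfl⟩ fun _ hc => Or.inr (h.subset hc).2

theorem IsMaxChainIcc.insert {x p y : P} {C : Set P} (h : IsMaxChainIcc p y C) (hx : x ⋖ p)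
    (hp : p ≤ y) : IsMaxChainIcc x y (insert x C) where
  subset := by
    rintro z (rfl | hz)
    · exact ⟨le_rfl, hx.le.trans hp⟩
    · exact ⟨hx.le.trans (h.subset hz).1, (h.subset hz).2⟩
  chain := by
    rintro a (rfl | ha) b (rfl | hb)
    · exact Or.inl le_rfl
    · exact Or.inl (hx.le.trans (h.subset hb).1)
    · exact Or.inr (hx.le.trans (h.subset ha).1)
    · exact h.chain a ha b hb
  max := by
    intro z hz hc
    rcases hc p (Or.inr (h.left_mem hp)) with h1 | h1
    · rcases hx.eq_or_eq hz.1 h1 with rfl | rfl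
      · exact Or.inl rfl
      · exact Or.inr (h.left_mem hp)
    · exact Or.inr (h.max z ⟨h1, hz.2⟩ fun c hcC => hc c (Or.inr hcC))

theorem IsMaxChainIcc.exists_covBy [Finite P] {x y : P} {C : Set P} (h : IsMaxChainIcc x y C)
    (hxy : x < y) : ∃ p, x ⋖ p ∧ p ≤ y ∧ IsMaxChainIcc p y (C \ {x}) := by
  have hne : (C \ {x}).Nonempty := ⟨y, h.right_mem hxy.le, hxy.ne'⟩
  obtain ⟨p, hp, hmin⟩ := (Set.toFinite (C \ {x})).exists_minimal hne
  have hle : ∀ c ∈ C \ {x}, p ≤ c := fun c hc =>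
    (h.chain p hp.1 c hc.1).elim id fun h1 => hmin hc h1
  have hxp : x < p := lt_of_le_of_ne (h.subset hp.1).1 (Ne.symm hp.2)
  have hpy : p ≤ y := (h.subset hp.1).2
  refine ⟨p, ⟨hxp, fun z hxz hzp => ?_⟩, hpy, ⟨fun z hz => ⟨hle z hz, (h.subset hz.1).2⟩,
    fun a ha b hb => h.chain a ha.1 b hb.1, fun z hz hc => ?_⟩⟩
  · refine hzp.not_ge (hle z ⟨h.max z ⟨hxz.le, hzp.le.trans hpy⟩ fun c hc => ?_, hxz.ne'⟩)
    by_cases hcx : c = x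
    · exact Or.inr (hcx ▸ hxz.le)
    · exact Or.inl (hzp.le.trans (hle c ⟨hc, hcx⟩))
  · have hxz : x < z := hxp.trans_le hz.1
    refine ⟨h.max z ⟨hxz.le, hz.2⟩ fun c hcC => ?_, hxz.ne'⟩
    by_cases hcx : c = x
    · exact Or.inr (hcx ▸ hxz.le)
    · exact hc c ⟨hcC, hcx⟩

/-- Maximal chains of the type `[x, y]` are maximal chains of the interval. -/
def flagEquiv (x y : P) : Flag (Set.Icc x y) ≃ {C : Set P // IsMaxChainIcc x y C} where
  toFun F := ⟨Subtype.val '' (F : Set (Set.Icc x y)), by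
    refine ⟨?_, ?_, ?_⟩
    · rintro _ ⟨z, -, rfl⟩
      exact z.2
    · rintro _ ⟨a, ha, rfl⟩ _ ⟨b, hb, rfl⟩
      exact F.le_or_le ha hb
    · intro z hz hc
      refine ⟨⟨z, hz⟩, ?_, rfl⟩
      exact Flag.mem_iff_forall_le_or_ge.2 fun b hb => hc b ⟨b, hb, rfl⟩⟩
  invFun C := Flag.ofIsMaxChain (Subtype.val ⁻¹' C.1) (by
    refine ⟨fun a ha b hb _ => C.2.chain a ha b hb, fun t ht hCt => ?_⟩
    refine hCt.antisymm fun z hz => C.2.max z z.2 fun c hc => ?_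
    exact ht.total hz (hCt (show (⟨c, C.2.subset hc⟩ : Set.Icc x y) ∈ Subtype.val ⁻¹' C.1 from hc)))
  left_inv F := by
    ext z
    simp
  right_inv C := by
    refine Subtype.ext ?_
    change Subtype.val '' (Subtype.val ⁻¹' C.1) = C.1
    rw [Subtype.image_preimage_coe, Set.inter_eq_right.2 C.2.subset]

theorem numMaxChains_eq_ncard (x y : P) [BoundedOrder P] [GradeMinOrder ℕ P] :
    numMaxChains x y = {C : Set P | IsMaxChainIcc x y C}.ncard :=
  Nat.card_congr (flagEquiv x y)

end Chains

/-! ### Rank levels of intervals, the chain recursion and the Euler relation. -/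

section Layers

variable {P : Type*} [Fintype P] [PartialOrder P] [BoundedOrder P] [GradeMinOrder ℕ P]

open Classical in
/-- The elements of the interval `[x, y]` whose rank in this interval is `j`. -/
noncomputable def layer (x y : P) (j : ℕ) : Finset P :=
  {z | x ≤ z ∧ z ≤ y ∧ grade ℕ z = grade ℕ x + j}

theorem mem_layer {x y z : P} {j : ℕ} :
    z ∈ layer x y j ↔ x ≤ z ∧ z ≤ y ∧ grade ℕ z = grade ℕ x + j := by
  simp [layer]

theorem eq_of_le_of_grade_le {x y : P} (h : x ≤ y) (hr : grade ℕ y ≤ grade ℕ x) : x = y := by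
  by_contra hne
  exact (grade_strictMono (𝕆 := ℕ) (lt_of_le_of_ne h hne)).not_ge hr

theorem grade_le_grade_of_le {x y : P} (h : x ≤ y) : grade ℕ x ≤ grade ℕ y :=
  grade_mono h

theorem mem_layer_one_iff_covBy {x y p : P} : p ∈ layer x y 1 ↔ x ⋖ p ∧ p ≤ y := by
  rw [mem_layer]
  constructor
  · rintro ⟨h1, h2, h3⟩
    have hlt : x < p := lt_of_le_of_ne h1 (by rintro rfl; omega)
    refine ⟨⟨hlt, fun z hz hz' => ?_⟩, h2⟩
    have := grade_strictMono (𝕆 := ℕ) hz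
    have := grade_strictMono (𝕆 := ℕ) hz'
    omega
  · rintro ⟨h1, h2⟩
    have h3 := h1.grade ℕ
    rw [Nat.covBy_iff_add_one_eq] at h3
    exact ⟨h1.le, h2, h3.symm⟩

theorem layer_one_nonempty {x y : P} (h : x < y) : (layer x y 1).Nonempty := by
  obtain ⟨p, hp, hpy⟩ := exists_covBy_le_of_lt h
  exact ⟨p, mem_layer_one_iff_covBy.2 ⟨hp, hpy⟩⟩

theorem layer_zero {x y : P} (h : x ≤ y) : layer x y 0 = {x} := by
  ext z
  rw [mem_layer, Finset.mem_singleton]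
  constructor
  · rintro ⟨h1, -, h3⟩
    exact (eq_of_le_of_grade_le h1 (by omega)).symm
  · rintro rfl
    exact ⟨le_rfl, h, by omega⟩

theorem layer_top {x y : P} {n : ℕ} (h : x ≤ y) (hn : grade ℕ y = grade ℕ x + n) :
    layer x y n = {y} := by
  ext z
  rw [mem_layer, Finset.mem_singleton]
  constructor
  · rintro ⟨-, h2, h3⟩
    exact eq_of_le_of_grade_le h2 (by omega)
  · rintro rfl
    exact ⟨h, le_rfl, hn⟩

theorem lt_of_mem_layer_succ {x y p : P} {j : ℕ} (h : p ∈ layer x y (j + 1)) : x < p := by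
  rw [mem_layer] at h
  exact lt_of_le_of_ne h.1 (by rintro rfl; omega)

theorem exists_grade_eq {k : ℕ} (hk : k ≤ grade ℕ (⊤ : P)) : ∃ x : P, grade ℕ x = k := by
  induction k with
  | zero => exact ⟨⊥, grade_bot⟩
  | succ k ih =>
    obtain ⟨x, hx⟩ := ih (by omega)
    have hlt : x < ⊤ := lt_top_iff_ne_top.2 (by rintro rfl; omega)
    obtain ⟨p, hp⟩ := layer_one_nonempty hlt
    exact ⟨p, by rw [(mem_layer.1 hp).2.2, hx]⟩

theorem numMaxChains_self (x : P) : numMaxChains x x = 1 := by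
  rw [numMaxChains_eq_ncard, Set.ncard_eq_one]
  refine ⟨{x}, Set.eq_singleton_iff_unique_mem.2 ⟨⟨by simp, by simp, by simp⟩, fun C hC => ?_⟩⟩
  refine Set.Subset.antisymm ?_ (by simpa using hC.left_mem le_rfl)
  simpa using hC.subset

/-- Deleting $x$ from a maximal chain of $[x,y]$ leaves a maximal chain of $[p,y]$ for a unique atom
$p$, and inserting $x$ reverses this. -/
theorem numMaxChains_eq_sum {x y : P} (h : x < y) :
    numMaxChains x y = ∑ p ∈ layer x y 1, numMaxChains p y := by
  classical
  let S : P → Finset (Set P) := fun x => Finset.univ.filter (IsMaxChainIcc x y)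
  have hS : ∀ x, numMaxChains x y = (S x).card := fun x => by
    rw [numMaxChains_eq_ncard, ← Set.ncard_coe_finset]
    congr 1
    ext C
    simp [S]
  have hnot : ∀ p C, x ⋖ p → IsMaxChainIcc p y C → x ∉ C := fun p C hp hC hx =>
    hp.lt.not_ge (hC.subset hx).1
  have hU : S x = (layer x y 1).biUnion fun p => (S p).image (insert x) := by
    ext C
    simp only [S, Finset.mem_filter, Finset.mem_univ, true_and, Finset.mem_biUnion,
      Finset.mem_image, mem_layer_one_iff_covBy]
    constructor
    · intro hC
      obtain ⟨p, hxp, hpy, hC'⟩ := hC.exists_covBy h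
      exact ⟨p, ⟨hxp, hpy⟩, _, hC', by simp [hC.left_mem h.le]⟩
    · rintro ⟨p, ⟨hxp, hpy⟩, C', hC', rfl⟩
      exact hC'.insert hxp hpy
  have hinj : ∀ p C q C', x ⋖ p → x ⋖ q → IsMaxChainIcc p y C → IsMaxChainIcc q y C' →
      insert x C = insert x C' → C = C' := by
    intro p C q C' hp hq hC hC' he
    have := congrArg (· \ {x}) he
    simpa [hnot p C hp hC, hnot q C' hq hC'] using this
  rw [hS, hU, Finset.card_biUnion]
  · refine Finset.sum_congr rfl fun p hp => ?_
    rw [hS, Finset.card_image_of_injOn]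
    intro C hC C' hC' he
    simp only [S, Finset.coe_filter, Finset.mem_univ, true_and, Set.mem_ofPred_eq] at hC hC'
    have hp := (mem_layer_one_iff_covBy.1 hp).1
    exact hinj p C p C' hp hp hC hC' he
  · intro p hp q hq hpq
    refine Finset.disjoint_left.2 ?_
    rintro _ h1 h2
    simp only [S, Finset.mem_filter, Finset.mem_univ, true_and, Finset.mem_image] at h1 h2
    obtain ⟨C, hC, rfl⟩ := h1
    obtain ⟨C', hC', he⟩ := h2
    rw [Finset.mem_coe, mem_layer_one_iff_covBy] at hp hq
    have := hinj q C' p C hq.1 hp.1 hC' hC he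
    subst this
    exact hpq (le_antisymm (hC.subset (hC'.left_mem hq.2)).1 (hC'.subset (hC.left_mem hp.2)).1)

theorem numMaxChains_pos {x y : P} (h : x ≤ y) : 0 < numMaxChains x y := by
  have : Nonempty (Flag (Set.Icc x y)) :=
    ⟨(Flag.exists_mem (⟨x, le_rfl, h⟩ : Set.Icc x y)).choose⟩
  exact Nat.card_pos

/-- Both sides count pairs $p\le z$ with $p$ an atom and $z$ of relative rank $j+1$. -/
theorem sum_card_layer_one (x y : P) (j : ℕ) :
    ∑ z ∈ layer x y (j + 1), (layer x z 1).card = ∑ p ∈ layer x y 1, (layer p y j).card := by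
  simp only [Finset.card_eq_sum_ones]
  refine Finset.sum_comm' fun z p => ?_
  simp only [mem_layer]
  constructor
  · rintro ⟨⟨h1, h2, h3⟩, h4, h5, h6⟩
    exact ⟨⟨h5, h2, by omega⟩, h4, h5.trans h2, h6⟩
  · rintro ⟨⟨h1, h2, h3⟩, h4, h5, h6⟩
    exact ⟨⟨h4.trans h1, h2, by omega⟩, h4, h1, h6⟩

theorem IsEulerian.sum_card_layer (hE : IsEulerian P) {x y : P} {n : ℕ} (hxy : x < y)
    (hn : grade ℕ y = grade ℕ x + n) :
    ∑ j ∈ Finset.range (n + 1), (-1 : ℤ) ^ j * (layer x y j).card = 0 := by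
  classical
  let s : Finset P := {z | x ≤ z ∧ z ≤ y}
  have h0 : ∑ z ∈ s, (-1 : ℤ) ^ grade ℕ z = 0 := by
    have h := hE x y hxy
    have e1 : {z ∈ Set.Icc x y | Even (grade ℕ z)} = ↑(s.filter fun z => Even (grade ℕ z)) := by
      ext z; simp [s]
    have e2 : {z ∈ Set.Icc x y | Odd (grade ℕ z)} = ↑(s.filter fun z => ¬ Even (grade ℕ z)) := by
      ext z; simp [s]
    rw [e1, e2, Set.ncard_coe_finset, Set.ncard_coe_finset] at h
    rw [← Finset.sum_filter_add_sum_filter_not s fun z => Even (grade ℕ z),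
      Finset.sum_congr rfl fun z hz => (Finset.mem_filter.1 hz).2.neg_one_pow,
      Finset.sum_congr rfl fun z hz =>
        (Nat.not_even_iff_odd.1 (Finset.mem_filter.1 hz).2).neg_one_pow]
    simp [h]
  -- The truncated subtraction is exact, because $x\le z$ on `s`.
  have h1 : ∑ z ∈ s, (-1 : ℤ) ^ grade ℕ z =
      ∑ j ∈ Finset.range (n + 1), ∑ z ∈ s with grade ℕ z - grade ℕ x = j, (-1 : ℤ) ^ grade ℕ z := by
    refine (Finset.sum_fiberwise_of_maps_to (fun z hz => ?_) _).symm
    simp only [s, Finset.mem_filter, Finset.mem_univ, true_and] at hz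
    have := grade_le_grade_of_le hz.2
    rw [Finset.mem_range]
    omega
  have h2 : ∀ j, ∑ z ∈ s with grade ℕ z - grade ℕ x = j, (-1 : ℤ) ^ grade ℕ z =
      (-1) ^ grade ℕ x * ((-1 : ℤ) ^ j * (layer x y j).card) := by
    intro j
    have : s.filter (fun z => grade ℕ z - grade ℕ x = j) = layer x y j := by
      ext z
      simp only [s, Finset.mem_filter, Finset.mem_univ, true_and, mem_layer, and_assoc]
      refine and_congr_right fun hxz => and_congr_right fun _ => ?_
      have := grade_le_grade_of_le hxz
      omega
    rw [this, Finset.sum_congr rfl fun z hz => by rw [(mem_layer.1 hz).2.2], Finset.sum_const,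
      nsmul_eq_mul, pow_add]
    ring
  rw [h1, Finset.sum_congr rfl fun j _ => h2 j, ← Finset.mul_sum] at h0
  exact (mul_eq_zero.1 h0).resolve_left (by simp)

theorem IsEulerian.card_layer_one (hE : IsEulerian P) {x y : P} (hxy : x ≤ y)
    (hn : grade ℕ y = grade ℕ x + 2) : (layer x y 1).card = 2 := by
  have hlt : x < y := lt_of_le_of_ne hxy (by rintro rfl; omega)
  have h := hE.sum_card_layer hlt hn
  simp [Finset.sum_range_succ, layer_zero hxy, layer_top hxy hn] at h
  omega

end Layers

/-- Here `f p` plays the role of the equivalence class of `p`: the classes partition `s` into blocks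
of size `k`. -/
theorem dvd_card_of_classes {α : Type*} {s : Finset α} {f : α → Finset α} {k : ℕ}
    (hcard : ∀ p ∈ s, (f p).card = k) (hself : ∀ p ∈ s, p ∈ f p) (hsub : ∀ p ∈ s, f p ⊆ s)
    (heq : ∀ p ∈ s, ∀ q ∈ f p, f q = f p) : k ∣ s.card := by
  classical
  rw [Finset.card_eq_sum_card_image f s, Finset.sum_congr rfl (g := fun _ => k)]
  · simp
  · intro c hc
    obtain ⟨p, hp, rfl⟩ := Finset.mem_image.1 hc
    rw [← hcard p hp]
    congr 1
    ext q
    rw [Finset.mem_filter]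
    exact ⟨fun h => h.2 ▸ hself q h.1, fun h => ⟨hsub p hp h, heq p hp q h⟩⟩

/-! ### Joins of atoms in intervals that do not start at $\hat 0$. -/

section Upper

variable {P : Type*} [Fintype P] [PartialOrder P] [BoundedOrder P] [GradeMinOrder ℕ P]

variable (P) in
/-- Every `n`-interval not starting at `⊥` has exactly `a` atoms. -/
def AtomCount (n a : ℕ) : Prop :=
  ∀ x y : P, x ≠ ⊥ → x ≤ y → grade ℕ y = grade ℕ x + n → (layer x y 1).card = a

variable (P) in
/-- In every `n`-interval not starting at `⊥`, two distinct atoms have at most one common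
upper cover. -/
def UniqueJoin (n : ℕ) : Prop :=
  ∀ x y : P, x ≠ ⊥ → x ≤ y → grade ℕ y = grade ℕ x + n → ∀ p ∈ layer x y 1, ∀ q ∈ layer x y 1,
    p ≠ q → ∀ e ∈ layer x y 2, ∀ e' ∈ layer x y 2, p ≤ e → q ≤ e → p ≤ e' → q ≤ e' → e = e'

variable (P) in
/-- In every `n`-interval not starting at `⊥`, two distinct atoms have a common upper cover. -/
def ExistsJoin (n : ℕ) : Prop :=
  ∀ x y : P, x ≠ ⊥ → x ≤ y → grade ℕ y = grade ℕ x + n → ∀ p ∈ layer x y 1, ∀ q ∈ layer x y 1,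
    p ≠ q → ∃ e ∈ layer x y 2, p ≤ e ∧ q ≤ e

theorem ne_bot_of_le_of_ne_bot {x y : P} (hx : x ≠ ⊥) (h : x ≤ y) : y ≠ ⊥ := by
  rintro rfl
  exact hx (le_bot_iff.1 h)

theorem mem_layer_trans {x p e y : P} {i j : ℕ} (hp : p ∈ layer x y i) (he : e ∈ layer p y j) :
    e ∈ layer x y (i + j) := by
  rw [mem_layer] at *
  exact ⟨hp.1.trans he.1, he.2.1, by omega⟩

theorem mem_layer_of_le {x p e y : P} {i j : ℕ} (hp : p ∈ layer x y i)
    (he : e ∈ layer x y (i + j)) (h : p ≤ e) : e ∈ layer p y j := by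
  rw [mem_layer] at *
  exact ⟨h, he.2.1, by omega⟩

theorem mem_layer_right {x p e y : P} {i j : ℕ} (hp : p ∈ layer x y i) (he : e ∈ layer p y j) :
    p ∈ layer x e i := by
  rw [mem_layer] at *
  exact ⟨hp.1, he.1, by omega⟩

theorem layer_mono_right {x y z : P} (j : ℕ) (h : y ≤ z) : layer x y j ⊆ layer x z j := by
  intro p hp
  rw [mem_layer] at *
  exact ⟨hp.1, hp.2.1.trans h, hp.2.2⟩

theorem mem_layer_cut {x y z p : P} {j : ℕ} (hp : p ∈ layer x y j) (h : p ≤ z) :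
    p ∈ layer x z j := by
  rw [mem_layer] at *
  exact ⟨hp.1, h, hp.2.2⟩

theorem exists_other_atom (h2 : ∀ x y : P, x ≤ y → grade ℕ y = grade ℕ x + 2 →
    (layer x y 1).card = 2) {x e p : P} (he : grade ℕ e = grade ℕ x + 2) (hp : p ∈ layer x e 1) :
    ∃ q ∈ layer x e 1, q ≠ p ∧ ∀ r ∈ layer x e 1, r = p ∨ r = q := by
  classical
  obtain ⟨a, b, hab, hs⟩ := Finset.card_eq_two.1
    (h2 x e ((mem_layer.1 hp).1.trans (mem_layer.1 hp).2.1) he)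
  rw [hs, Finset.mem_insert, Finset.mem_singleton] at hp
  rcases hp with rfl | rfl
  · exact ⟨b, by simp [hs], hab.symm, by simp [hs]⟩
  · exact ⟨a, by simp [hs], hab, fun r hr => by simpa [hs, or_comm] using hr⟩

/-- If $e\ne e'$ both covered $p$ and $q$, neither would lie over the third atom $r$. Some $g$ of
relative rank 2 does, and its other atom is $p$ or $q$; that atom then has three upper covers
$e,e',g$ in a 2-interval, which allows only two. -/
theorem uniqueJoin_three (h2 : ∀ x y : P, x ≤ y → grade ℕ y = grade ℕ x + 2 →
    (layer x y 1).card = 2) (h3 : AtomCount P 3 3) : UniqueJoin P 3 := by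
  classical
  intro x y hx hxy hr p hp q hq hpq e he e' he' hpe hqe hpe' hqe'
  by_contra hne
  have hc := h3 x y hx hxy hr
  have atoms : ∀ e ∈ layer x y 2, p ≤ e → q ≤ e → layer x e 1 = {p, q} := by
    intro e he hpe hqe
    refine (Finset.eq_of_subset_of_card_le ?_ ?_).symm
    · intro s hs
      rw [Finset.mem_insert, Finset.mem_singleton] at hs
      rcases hs with rfl | rfl
      · exact mem_layer_cut hp hpe
      · exact mem_layer_cut hq hqe
    · rw [Finset.card_pair hpq, h2 x e (mem_layer.1 he).1 (mem_layer.1 he).2.2]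
  obtain ⟨r, hrL, hrn⟩ : ∃ r ∈ layer x y 1, r ∉ ({p, q} : Finset P) := by
    by_contra! hcon
    have := Finset.card_le_card hcon
    rw [Finset.card_pair hpq] at this
    omega
  have hsub : ({p, q, r} : Finset P) = layer x y 1 := by
    refine Finset.eq_of_subset_of_card_le ?_ ?_
    · intro s hs
      simp only [Finset.mem_insert, Finset.mem_singleton] at hs
      rcases hs with rfl | rfl | rfl <;> assumption
    · rw [Finset.card_eq_three.2 ⟨p, q, r, hpq, by rintro rfl; simp at hrn,
        by rintro rfl; simp at hrn, rfl⟩, hc]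
  have hry : r < y := by
    refine lt_of_le_of_ne (mem_layer.1 hrL).2.1 ?_
    rintro rfl
    have := (mem_layer.1 hrL).2.2
    omega
  obtain ⟨g, hg⟩ := layer_one_nonempty hry
  have hg2 : g ∈ layer x y 2 := mem_layer_trans hrL hg
  have hge : ∀ e ∈ layer x y 2, p ≤ e → q ≤ e → g ≠ e := by
    rintro e he hpe hqe rfl
    exact hrn (atoms g he hpe hqe ▸ mem_layer_right hrL hg)
  obtain ⟨s, hs, hsr, -⟩ := exists_other_atom h2 (mem_layer.1 hg2).2.2 (mem_layer_right hrL hg)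
  have hsL := layer_mono_right 1 (mem_layer.1 hg).2.1 hs
  have key : ∀ t ∈ layer x y 1, t ≤ e → t ≤ e' → t ≤ g → False := by
    intro t ht h1 h2' h3'
    have hcard := h2 t y (mem_layer.1 ht).2.1 (by rw [hr, (mem_layer.1 ht).2.2])
    have hle : ({e, e', g} : Finset P).card ≤ (layer t y 1).card := by
      refine Finset.card_le_card ?_
      intro u hu
      simp only [Finset.mem_insert, Finset.mem_singleton] at hu
      rcases hu with rfl | rfl | rfl <;>
        exact mem_layer_of_le (j := 1) ht (by assumption) (by assumption)
    rw [Finset.card_eq_three.2 ⟨e, e', g, hne, (hge e he hpe hqe).symm,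
      (hge e' he' hpe' hqe').symm, rfl⟩] at hle
    omega
  rw [← hsub] at hsL
  simp only [Finset.mem_insert, Finset.mem_singleton] at hsL
  rcases hsL with rfl | rfl | rfl
  · exact key s hp hpe hpe' (mem_layer.1 hs).2.1
  · exact key s hq hqe hqe' (mem_layer.1 hs).2.1
  · exact hsr rfl

/-- Two upper covers $e,e'$ of $p$ are atoms of the $n$-interval $[p,y]$, so some $f$ covers both;
the claim then takes place in the 3-interval $[x,f]$. -/
theorem uniqueJoin_of_existsJoin {n : ℕ} (hU : UniqueJoin P 3) (hE : ExistsJoin P n) :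
    UniqueJoin P (n + 1) := by
  intro x y hx hxy hr p hp q hq hpq e he e' he' hpe hqe hpe' hqe'
  by_contra hne
  have hpm := mem_layer.1 hp
  have hpb := ne_bot_of_le_of_ne_bot hx hpm.1
  obtain ⟨f, hf, hef, hef'⟩ := hE p y hpb hpm.2.1 (by omega) e (mem_layer_of_le hp he hpe) e'
    (mem_layer_of_le hp he' hpe') hne
  have hf3 := mem_layer.1 (mem_layer_trans hp hf)
  exact hne (hU x f hx hf3.1 hf3.2.2 p (mem_layer_cut hp (hpe.trans hef)) q
    (mem_layer_cut hq (hqe.trans hef)) hpq e (mem_layer_cut he hef) e' (mem_layer_cut he' hef')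
    hpe hqe hpe' hqe')

/-- The number of atoms of `[x, y]` sharing an upper cover with a given atom `p`, including `p`. -/
theorem exists_other_atoms {n : ℕ} (h2 : ∀ x y : P, x ≤ y → grade ℕ y = grade ℕ x + 2 →
    (layer x y 1).card = 2) (hU : UniqueJoin P (n + 1)) (ha : AtomCount P n n) {x y p : P}
    (hx : x ≠ ⊥) (hxy : x ≤ y) (hr : grade ℕ y = grade ℕ x + (n + 1)) (hp : p ∈ layer x y 1) :
    ∃ s : Finset P, s.card = n ∧ ∀ q, q ∈ s ↔ q ∈ layer x y 1 ∧ q ≠ p ∧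
      ∃ e ∈ layer x y 2, p ≤ e ∧ q ≤ e := by
  classical
  have hpm := mem_layer.1 hp
  have hpb := ne_bot_of_le_of_ne_bot hx hpm.1
  have hother : ∀ e ∈ layer p y 1, ∃ q ∈ layer x e 1, q ≠ p ∧ ∀ r ∈ layer x e 1, r = p ∨ r = q :=
    fun e he => exists_other_atom h2 (mem_layer.1 (mem_layer_trans hp he)).2.2
      (mem_layer_right hp he)
  choose! f hf hfp hfu using hother
  -- Each of the $n$ upper covers $e$ of $p$ contributes its second atom `f e`, and uniqueness of
  -- joins makes `f` injective. The atom $p$ itself is not in the image.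
  refine ⟨(layer p y 1).image f, ?_, fun q => ?_⟩
  · rw [Finset.card_image_of_injOn, ha p y hpb hpm.2.1 (by omega)]
    intro e he e' he' hee
    have he2 := mem_layer_trans hp he
    have he2' := mem_layer_trans hp he'
    exact hU x y hx hxy hr p hp (f e) (layer_mono_right 1 (mem_layer.1 he).2.1 (hf e he))
      (hfp e he).symm e he2 e' he2' (mem_layer.1 he).1 (mem_layer.1 (hf e he)).2.1
      (mem_layer.1 he').1 (by rw [hee]; exact (mem_layer.1 (hf e' he')).2.1)
  · rw [Finset.mem_image]
    constructor
    · rintro ⟨e, he, rfl⟩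
      exact ⟨layer_mono_right 1 (mem_layer.1 he).2.1 (hf e he), hfp e he, e,
        mem_layer_trans hp he, (mem_layer.1 he).1, (mem_layer.1 (hf e he)).2.1⟩
    · rintro ⟨hq, hqp, e, he, hpe, hqe⟩
      have he1 := mem_layer_of_le (j := 1) hp he hpe
      exact ⟨e, he1, (((hfu e he1) q (mem_layer_cut hq hqe)).resolve_left hqp).symm⟩

/-- An atom shares an upper cover with exactly $n$ others, and there are only $n$ others. -/
theorem existsJoin_of_uniqueJoin {n : ℕ} (h2 : ∀ x y : P, x ≤ y → grade ℕ y = grade ℕ x + 2 →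
    (layer x y 1).card = 2) (hU : UniqueJoin P (n + 1)) (ha : AtomCount P n n)
    (ha' : AtomCount P (n + 1) (n + 1)) : ExistsJoin P (n + 1) := by
  classical
  intro x y hx hxy hr p hp q hq hpq
  obtain ⟨s, hs, hmem⟩ := exists_other_atoms h2 hU ha hx hxy hr hp
  have : s = (layer x y 1).erase p := by
    refine Finset.eq_of_subset_of_card_le (fun q hq => ?_) ?_
    · rw [hmem] at hq
      exact Finset.mem_erase.2 ⟨hq.2.1, hq.1⟩
    · rw [Finset.card_erase_of_mem hp, ha' x y hx hxy hr, hs]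
      omega
  have hqs : q ∈ s := this ▸ Finset.mem_erase.2 ⟨hpq.symm, hq⟩
  exact ((hmem q).1 hqs).2.2

theorem uniqueJoin_and_existsJoin (h2 : ∀ x y : P, x ≤ y → grade ℕ y = grade ℕ x + 2 →
    (layer x y 1).card = 2) {N : ℕ} (ha : ∀ n ≤ N, AtomCount P n n)
    (n : ℕ) (hn : n + 2 ≤ N) : UniqueJoin P (n + 2) ∧ ExistsJoin P (n + 2) := by
  induction n with
  | zero =>
    have hU : UniqueJoin P 2 := by
      intro x y hx hxy hr p hp q hq hpq e he e' he' _ _ _ _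
      rw [layer_top hxy hr, Finset.mem_singleton] at he he'
      rw [he, he']
    exact ⟨hU, existsJoin_of_uniqueJoin h2 hU (ha 1 (by omega)) (ha 2 (by omega))⟩
  | succ n ih =>
    have hU : UniqueJoin P (n + 2 + 1) :=
      uniqueJoin_of_existsJoin (uniqueJoin_three h2 (ha 3 (by omega))) (ih (by omega)).2
    exact ⟨hU, existsJoin_of_uniqueJoin h2 hU (ha (n + 2) (by omega)) (ha (n + 3) hn)⟩

/-- Sharing an upper cover is an equivalence relation on the atoms, with classes of size $n+1$. The
bound $3\le n$ makes joins available in 3-intervals, which transitivity needs. -/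
theorem dvd_card_layer_one (h2 : ∀ x y : P, x ≤ y → grade ℕ y = grade ℕ x + 2 →
    (layer x y 1).card = 2) {n : ℕ} (hn : 3 ≤ n) (ha : ∀ j ≤ n, AtomCount P j j) {x y : P}
    (hx : x ≠ ⊥) (hxy : x ≤ y) (hr : grade ℕ y = grade ℕ x + (n + 1)) :
    n + 1 ∣ (layer x y 1).card := by
  classical
  obtain ⟨m, rfl⟩ := Nat.exists_eq_add_of_le' hn
  have hE : ExistsJoin P (m + 3) := (uniqueJoin_and_existsJoin h2 ha (m + 1) le_rfl).2
  have hE3 : ExistsJoin P 3 := (uniqueJoin_and_existsJoin h2 ha 1 (by omega)).2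
  have hU : UniqueJoin P (m + 3 + 1) :=
    uniqueJoin_of_existsJoin (uniqueJoin_three h2 (ha 3 (by omega))) hE
  have hs := fun p (hp : p ∈ layer x y 1) =>
    exists_other_atoms h2 hU (ha (m + 3) le_rfl) hx hxy hr hp
  choose! s hs hmem using hs
  let R : P → P → Prop := fun p q => ∃ e ∈ layer x y 2, p ≤ e ∧ q ≤ e
  have htrans : ∀ p ∈ layer x y 1, ∀ q ∈ layer x y 1, ∀ r ∈ layer x y 1, p ≠ r →
      R p q → R q r → R p r := by
    rintro p hp q hq r hr' hpr ⟨e, he, hpe, hqe⟩ ⟨e', he', hqe', hre'⟩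
    have hqm := mem_layer.1 hq
    by_cases hee : e = e'
    · subst hee
      exact ⟨e, he, hpe, hre'⟩
    -- A common upper cover $f$ of $e$ and $e'$ puts $p,q,r$ into the 3-interval $[x,f]$, where any
    -- two atoms have a common upper cover.
    obtain ⟨f, hf, hef, hef'⟩ := hE q y (ne_bot_of_le_of_ne_bot hx hqm.1) hqm.2.1 (by omega) e
      (mem_layer_of_le hq he hqe) e' (mem_layer_of_le hq he' hqe') hee
    have hf3 := mem_layer.1 (mem_layer_trans hq hf)
    obtain ⟨g, hg, hpg, hrg⟩ := hE3 x f hx hf3.1 hf3.2.2 p (mem_layer_cut hp (hpe.trans hef)) r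
      (mem_layer_cut hr' (hre'.trans hef')) hpr
    exact ⟨g, layer_mono_right 2 hf3.2.1 hg, hpg, hrg⟩
  have hsymm : ∀ p q, R p q → R q p := fun p q ⟨e, he, h, h'⟩ => ⟨e, he, h', h⟩
  have hmem' : ∀ p ∈ layer x y 1, ∀ q, q ∈ insert p (s p) ↔
      q ∈ layer x y 1 ∧ (q = p ∨ R p q) := by
    intro p hp q
    rw [Finset.mem_insert, hmem p hp]
    by_cases h : q = p
    · simp [h, hp]
    · simp [h, R]
  refine dvd_card_of_classes (f := fun p => insert p (s p)) ?_ ?_ ?_ ?_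
  · intro p hp
    rw [Finset.card_insert_of_notMem, hs p hp]
    rw [hmem p hp]
    simp
  · simp
  · intro p hp q hq
    exact ((hmem' p hp q).1 hq).1
  · intro p hp q hq
    have hq' := (hmem' p hp q).1 hq
    ext r
    rw [hmem' p hp, hmem' q hq'.1]
    refine and_congr_right fun hrL => ?_
    rcases hq'.2 with rfl | hpq
    · rfl
    constructor
    · rintro (rfl | h)
      · exact Or.inr hpq
      · by_cases hrp : r = p
        · exact Or.inl hrp
        · exact Or.inr (htrans p hp q hq'.1 r hrL (Ne.symm hrp) hpq h)
    · rintro (rfl | h)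
      · exact Or.inr (hsymm _ _ hpq)
      · by_cases hrq : r = q
        · exact Or.inl hrq
        · exact Or.inr (htrans q hq'.1 p hp r hrL (Ne.symm hrq) (hsymm _ _ hpq) h)

end Upper

/-! ### Level sizes and the Euler relation determine the atom counts of upper intervals. -/

section Counting

variable {P : Type*} [Fintype P] [PartialOrder P] [BoundedOrder P] [GradeMinOrder ℕ P]

theorem card_layer_succ_mul {x y : P} {j c w : ℕ}
    (hc : ∀ z ∈ layer x y (j + 1), (layer x z 1).card = c)
    (hw : ∀ p ∈ layer x y 1, (layer p y j).card = w) :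
    (layer x y (j + 1)).card * c = (layer x y 1).card * w := by
  have h := sum_card_layer_one x y j
  rwa [Finset.sum_congr rfl hc, Finset.sum_congr rfl hw, Finset.sum_const, Finset.sum_const,
    smul_eq_mul, smul_eq_mul] at h

theorem card_layer_eq_choose {N : ℕ} (ha : ∀ n ≤ N, AtomCount P n n) {n j : ℕ} (hn : n ≤ N)
    (hj : j ≤ n) {x y : P} (hx : x ≠ ⊥) (hxy : x ≤ y) (hr : grade ℕ y = grade ℕ x + n) :
    (layer x y j).card = n.choose j := by
  induction j generalizing n x with
  | zero => simp [layer_zero hxy]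
  | succ j ih =>
    obtain ⟨n, rfl⟩ := Nat.exists_eq_add_of_le' (Nat.one_le_of_lt hj)
    have h := card_layer_succ_mul (x := x) (y := y) (j := j) (c := j + 1) (w := n.choose j)
      (fun z hz => ha (j + 1) (by omega) x z hx (mem_layer.1 hz).1 (mem_layer.1 hz).2.2)
      (fun p hp => ih (n := n) (by omega) (by omega)
        (ne_bot_of_le_of_ne_bot hx (mem_layer.1 hp).1) (mem_layer.1 hp).2.1
        (by rw [hr, (mem_layer.1 hp).2.2]; ring))
    rw [ha (n + 1) hn x y hx hxy hr, Nat.add_one_mul_choose_eq] at h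
    exact Nat.eq_of_mul_eq_mul_right (by omega) h

/-- The full alternating sum vanishes; the two outermost terms at each end are moved to the other
side. -/
theorem alternating_sum_middle_choose (l : ℕ) (hl : Odd l) :
    ∑ i ∈ Finset.range l, (-1 : ℤ) ^ i * ((l + 3).choose (i + 2) : ℤ) = 2 * l + 4 := by
  have h := Int.alternating_sum_range_choose (n := l + 3)
  rw [Finset.sum_range_succ, Finset.sum_range_succ, Finset.sum_range_succ',
    Finset.sum_range_succ'] at h
  have e : ∀ i ∈ Finset.range l, (-1 : ℤ) ^ (i + 1 + 1) * ((l + 3).choose (i + 1 + 1) : ℤ) =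
      (-1 : ℤ) ^ i * ((l + 3).choose (i + 2) : ℤ) := fun i _ => by ring_nf
  have c1 : (l + 3).choose (l + 2) = l + 3 := Nat.choose_succ_self_right (l + 2)
  rw [Finset.sum_congr rfl e, c1] at h
  simp [pow_add, hl.neg_one_pow] at h
  linarith

theorem alternating_sum_middle_choose' (l : ℕ) (hl : Odd l) :
    ∑ i ∈ Finset.range l, (-1 : ℤ) ^ i * ((l + 2).choose (i + 1) : ℤ) = l + 2 := by
  have h := Int.alternating_sum_range_choose (n := l + 2)
  rw [Finset.sum_range_succ, Finset.sum_range_succ, Finset.sum_range_succ'] at h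
  have e : ∀ i ∈ Finset.range l, (-1 : ℤ) ^ (i + 1) * ((l + 2).choose (i + 1) : ℤ) =
      -((-1 : ℤ) ^ i * ((l + 2).choose (i + 1) : ℤ)) := fun i _ => by ring
  have c1 : (l + 2).choose (l + 1) = l + 2 := Nat.choose_succ_self_right (l + 1)
  rw [Finset.sum_congr rfl e, c1, Finset.sum_neg_distrib] at h
  simp [pow_add, hl.neg_one_pow] at h
  linarith

theorem IsEulerian.sum_card_middle_layers (hE : IsEulerian P) {x y : P} {l : ℕ} (hl : Odd l)
    (hxy : x ≤ y) (hr : grade ℕ y = grade ℕ x + (l + 3)) :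
    2 + ∑ i ∈ Finset.range l, (-1 : ℤ) ^ i * (layer x y (i + 2)).card =
      (layer x y 1).card + (layer x y (l + 2)).card := by
  have hlt : x < y := lt_of_le_of_ne hxy (by rintro rfl; omega)
  have h := hE.sum_card_layer hlt hr
  rw [Finset.sum_range_succ, Finset.sum_range_succ, Finset.sum_range_succ',
    Finset.sum_range_succ'] at h
  have e : ∀ i ∈ Finset.range l, (-1 : ℤ) ^ (i + 1 + 1) * ((layer x y (i + 1 + 1)).card : ℤ) =
      (-1 : ℤ) ^ i * ((layer x y (i + 2)).card : ℤ) := fun i _ => by ring_nf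
  rw [Finset.sum_congr rfl e, layer_zero hxy, layer_top hxy hr] at h
  simp [pow_add, hl.neg_one_pow] at h
  linarith

/-- In an Eulerian poset whose upper intervals of rank less than `l + 2` have boolean atom counts,
an interval of even rank `l + 3` has a boolean atom count, too. -/
theorem IsEulerian.atomCount_of_even (hE : IsEulerian P) {l α : ℕ} (hl : Odd l)
    (ha : ∀ j ≤ l + 1, AtomCount P j j) (hα : AtomCount P (l + 2) (α * (l + 2))) {x y : P}
    (hx : x ≠ ⊥) (hxy : x ≤ y) (hr : grade ℕ y = grade ℕ x + (l + 3)) :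
    α = 1 ∧ (layer x y 1).card = l + 3 := by
  have hlt : x < y := lt_of_le_of_ne hxy (by rintro rfl; omega)
  have hApos := (layer_one_nonempty hlt).card_pos
  set A := (layer x y 1).card with hA
  have hsub : ∀ p ∈ layer x y 1, p ≠ ⊥ ∧ p ≤ y ∧ grade ℕ y = grade ℕ p + (l + 2) := fun p hp =>
    ⟨ne_bot_of_le_of_ne_bot hx (mem_layer.1 hp).1, (mem_layer.1 hp).2.1, by
      rw [hr, (mem_layer.1 hp).2.2]; ring⟩
  have hαpos : 0 < α := by
    obtain ⟨p, hp⟩ := layer_one_nonempty hlt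
    have hp' := hsub p hp
    have := (layer_one_nonempty (lt_of_le_of_ne hp'.2.1 (by rintro rfl; omega))).card_pos
    rw [hα p y hp'.1 hp'.2.1 hp'.2.2] at this
    exact Nat.pos_of_mul_pos_right this
  have hco : ∀ p ∈ layer x y 1, ∀ i ≤ l,
      (layer p y (i + 1)).card * (i + 1) = α * (l + 2) * (l + 1).choose i := by
    intro p hp i hi
    have hp' := hsub p hp
    rw [← hα p y hp'.1 hp'.2.1 hp'.2.2]
    refine card_layer_succ_mul (fun z hz => ha (i + 1) (by omega) p z hp'.1 (mem_layer.1 hz).1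
      (mem_layer.1 hz).2.2) fun q hq => ?_
    exact card_layer_eq_choose ha le_rfl (by omega)
      (ne_bot_of_le_of_ne_bot hp'.1 (mem_layer.1 hq).1) (mem_layer.1 hq).2.1
      (by have := (mem_layer.1 hq).2.2; omega)
  -- The middle levels are $A\alpha/(l+3)$ times the boolean ones, while the number of coatoms is
  -- $A$, without the factor $\alpha$.
  have hW : ∀ i < l, (layer x y (i + 2)).card * (l + 3) = A * α * (l + 3).choose (i + 2) := by
    intro i hi
    obtain ⟨p, hp⟩ := layer_one_nonempty hlt
    have h1 := card_layer_succ_mul (x := x) (y := y) (j := i + 1) (c := i + 2)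
      (w := (layer p y (i + 1)).card)
      (fun z hz => ha (i + 2) (by omega) x z hx (mem_layer.1 hz).1 (mem_layer.1 hz).2.2)
      (fun q hq => Nat.eq_of_mul_eq_mul_right (Nat.succ_pos i)
        ((hco q hq i hi.le).trans (hco p hp i hi.le).symm))
    have h2 := hco p hp i hi.le
    have c1 := Nat.add_one_mul_choose_eq (l + 1) i
    have c2 := Nat.add_one_mul_choose_eq (l + 2) (i + 1)
    refine Nat.eq_of_mul_eq_mul_right (show 0 < (i + 2) * (i + 1) by positivity) ?_
    calc (layer x y (i + 2)).card * (l + 3) * ((i + 2) * (i + 1))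
        = ((layer x y (i + 1 + 1)).card * (i + 2)) * (i + 1) * (l + 3) := by ring
      _ = A * ((layer p y (i + 1)).card * (i + 1)) * (l + 3) := by rw [h1]; ring
      _ = A * α * ((l + 2 + 1) * ((l + 1 + 1) * (l + 1).choose i)) := by rw [h2]; ring
      _ = A * α * (((l + 2 + 1) * (l + 2).choose (i + 1)) * (i + 1)) := by rw [c1]; ring
      _ = A * α * (l + 3).choose (i + 2) * ((i + 2) * (i + 1)) := by rw [c2]; ring
  have hcoatoms : (layer x y (l + 2)).card = A := by
    have h1 := card_layer_succ_mul (x := x) (y := y) (j := l + 1) (c := α * (l + 2))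
      (w := α * (l + 2))
      (fun z hz => hα x z hx (mem_layer.1 hz).1 (mem_layer.1 hz).2.2)
      (fun q hq => by
        have h := hco q hq l le_rfl
        rw [Nat.choose_succ_self_right] at h
        exact Nat.eq_of_mul_eq_mul_right (Nat.succ_pos l) h)
    exact Nat.eq_of_mul_eq_mul_right (by positivity) h1
  have hsum := hE.sum_card_middle_layers hl hxy hr
  have hS : (∑ i ∈ Finset.range l, (-1 : ℤ) ^ i * (layer x y (i + 2)).card) * (l + 3) =
      A * α * (2 * l + 4) := by
    rw [← alternating_sum_middle_choose l hl, Finset.sum_mul, Finset.mul_sum]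
    refine Finset.sum_congr rfl fun i hi => ?_
    have := hW i (Finset.mem_range.1 hi)
    zify at this
    rw [mul_assoc, this]
    ring
  rw [hcoatoms] at hsum
  -- For $\alpha\ge 2$ the right side is at least $2A(l+2)$, more than $A(l+3)$; for $\alpha=1$ the
  -- equation reads $A=l+3$.
  have hfin : (l + 3 : ℤ) * (A - 1) = A * α * (l + 2) := by
    have : (∑ i ∈ Finset.range l, (-1 : ℤ) ^ i * (layer x y (i + 2)).card) = 2 * A - 2 := by
      linarith
    rw [this] at hS
    linarith
  have hα1 : α = 1 := by
    by_contra hne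
    have h2 : (2 : ℤ) ≤ α := by exact_mod_cast (by omega : 2 ≤ α)
    have hA1 : (1 : ℤ) ≤ A := by exact_mod_cast hApos
    have h3 : (A : ℤ) * (l + 2) * 2 ≤ A * (l + 2) * α :=
      mul_le_mul_of_nonneg_left h2 (by positivity)
    have h4 : (0 : ℤ) ≤ A * (l + 1) := by positivity
    nlinarith
  refine ⟨hα1, ?_⟩
  subst hα1
  zify
  push_cast at hfin
  linarith

theorem atomCount_zero : AtomCount P 0 0 := by
  intro x y _ hxy hr
  rw [Finset.card_eq_zero, Finset.eq_empty_iff_forall_notMem]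
  intro p hp
  have hp' := mem_layer.1 hp
  have := grade_le_grade_of_le hp'.2.1
  omega

theorem atomCount_one : AtomCount P 1 1 := by
  intro x y _ hxy hr
  rw [layer_top hxy hr, Finset.card_singleton]

theorem numMaxChains_of_grade_one {x y : P} (hxy : x ≤ y) (hr : grade ℕ y = grade ℕ x + 1) :
    numMaxChains x y = 1 := by
  have hlt : x < y := lt_of_le_of_ne hxy (by rintro rfl; omega)
  rw [numMaxChains_eq_sum hlt, layer_top hxy hr, Finset.sum_singleton, numMaxChains_self]

theorem numMaxChains_eq_mul {x y : P} (h : x < y) {b : ℕ}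
    (hb : ∀ p ∈ layer x y 1, numMaxChains p y = b) :
    numMaxChains x y = (layer x y 1).card * b := by
  rw [numMaxChains_eq_sum h, Finset.sum_congr rfl hb, Finset.sum_const, smul_eq_mul]

theorem IsEulerian.numMaxChains_of_grade_two (hE : IsEulerian P) {x y : P} (hxy : x ≤ y)
    (hr : grade ℕ y = grade ℕ x + 2) : numMaxChains x y = 2 := by
  have hlt : x < y := lt_of_le_of_ne hxy (by rintro rfl; omega)
  rw [numMaxChains_eq_mul hlt (b := 1), hE.card_layer_one hxy hr]
  intro p hp
  rw [mem_layer] at hp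
  exact numMaxChains_of_grade_one hp.2.1 (by omega)

theorem IsEulerian.numMaxChains_of_grade_three (hE : IsEulerian P) {x y : P} (hxy : x ≤ y)
    (hr : grade ℕ y = grade ℕ x + 3) : numMaxChains x y = (layer x y 1).card * 2 := by
  have hlt : x < y := lt_of_le_of_ne hxy (by rintro rfl; omega)
  refine numMaxChains_eq_mul hlt fun p hp => ?_
  rw [mem_layer] at hp
  exact hE.numMaxChains_of_grade_two hp.2.1 (by omega)

/-- Each of the atoms is followed by $B(n)$ chains. -/
theorem IsBinomialFactorialFunction.atomCount {B : ℕ → ℕ} (hB : IsBinomialFactorialFunction P B)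
    (n : ℕ) : AtomCount P (n + 1) (B (n + 1) / B n) := by
  intro x y hx hxy hr
  have hlt : x < y := lt_of_le_of_ne hxy (by rintro rfl; omega)
  have hsub : ∀ p ∈ layer x y 1, numMaxChains p y = B n := fun p hp =>
    hB n p y (ne_bot_of_le_of_ne_bot hx (mem_layer.1 hp).1) (mem_layer.1 hp).2.1
      (by have := (mem_layer.1 hp).2.2; omega)
  obtain ⟨p, hp⟩ := layer_one_nonempty hlt
  have hpos : 0 < B n := hsub p hp ▸ numMaxChains_pos (mem_layer.1 hp).2.1
  rw [← hB (n + 1) x y hx hxy hr, numMaxChains_eq_mul hlt hsub, Nat.mul_div_cancel _ hpos]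

theorem card_atoms_eq_div {B D : ℕ → ℕ} (hB : IsBinomialFactorialFunction P B)
    (hD : IsShefferFactorialFunction P D) {n : ℕ} {y : P} (hr : grade ℕ y = n + 1) :
    (layer ⊥ y 1).card = D (n + 1) / B n := by
  have hb : grade ℕ (⊥ : P) = 0 := grade_bot
  have hlt : ⊥ < y := bot_lt_iff_ne_bot.2 (by rintro rfl; omega)
  have hsub : ∀ p ∈ layer ⊥ y 1, numMaxChains p y = B n := fun p hp =>
    hB n p y (lt_of_mem_layer_succ (j := 0) hp).ne' (mem_layer.1 hp).2.1
      (by have := (mem_layer.1 hp).2.2; omega)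
  obtain ⟨p, hp⟩ := layer_one_nonempty hlt
  have hpos : 0 < B n := hsub p hp ▸ numMaxChains_pos (mem_layer.1 hp).2.1
  rw [← hD (n + 1) y hr, numMaxChains_eq_mul hlt hsub, Nat.mul_div_cancel _ hpos]

theorem IsEulerian.atomCount_three (hE : IsEulerian P) {B : ℕ → ℕ}
    (hB : IsBinomialFactorialFunction P B) (hB3 : B 3 = 6) : AtomCount P 3 3 := by
  intro x y hx hxy hr
  have h := hE.numMaxChains_of_grade_three hxy hr
  rw [hB 3 x y hx hxy hr, hB3] at h
  omega

theorem IsEulerian.atomCount_self (hE : IsEulerian P) {a : ℕ → ℕ}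
    (ha : ∀ n, AtomCount P (n + 1) (a (n + 1))) (h3 : AtomCount P 3 3) {m : ℕ}
    (hrank : grade ℕ (⊤ : P) = 2 * m + 1) (k : ℕ) (hk : k ≤ m) :
    ∀ j ≤ 2 * k, AtomCount P j j := by
  have h2 : ∀ x y : P, x ≤ y → grade ℕ y = grade ℕ x + 2 → (layer x y 1).card = 2 :=
    fun x y => hE.card_layer_one
  induction k with
  | zero =>
    intro j hj
    obtain rfl : j = 0 := by omega
    exact atomCount_zero
  | succ k ih =>
    have ih := ih (by omega)
    rcases Nat.eq_zero_or_pos k with rfl | hk0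
    · intro j hj
      obtain rfl | rfl | rfl : j = 0 ∨ j = 1 ∨ j = 2 := by omega
      · exact atomCount_zero
      · exact atomCount_one
      · exact fun x y _ => h2 x y
    -- This rank makes $[x,\hat 1]$ an interval of rank $2k+2$; it is positive because $k<m$.
    obtain ⟨x, hx⟩ := exists_grade_eq (P := P) (k := 2 * (m - k) - 1) (by omega)
    have hxb : x ≠ ⊥ := by
      rintro rfl
      rw [grade_bot, Nat.bot_eq_zero] at hx
      omega
    have hdvd : ∃ α, AtomCount P (2 * k + 1) (α * (2 * k + 1)) := by
      -- Divisibility needs $2k\ge 3$; for $k=1$ the value $B(3)=6$ takes its place.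
      rcases Nat.lt_or_ge 1 k with hk1 | hk1
      · have hlt : x < ⊤ := lt_top_iff_ne_top.2 (by rintro rfl; omega)
        obtain ⟨p, hp⟩ := layer_one_nonempty hlt
        have hpm := mem_layer.1 hp
        have hpb := ne_bot_of_le_of_ne_bot hxb hpm.1
        have hpr : grade ℕ (⊤ : P) = grade ℕ p + (2 * k + 1) := by omega
        obtain ⟨α, hα⟩ := dvd_card_layer_one h2 (by omega) ih hpb hpm.2.1 hpr
        refine ⟨α, ?_⟩
        have := ha (2 * k)
        rwa [← this p ⊤ hpb hpm.2.1 hpr, hα, mul_comm _ α] at this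
      · obtain rfl : k = 1 := by omega
        exact ⟨1, by simpa using h3⟩
    obtain ⟨α, hα⟩ := hdvd
    obtain ⟨l, rfl⟩ := Nat.exists_eq_add_of_le' hk0
    have key := hE.atomCount_of_even (l := 2 * l + 1) (by simp) ih hα hxb le_top (by omega)
    intro j hj
    rcases Nat.lt_or_ge j (2 * (l + 1) + 1) with h | h
    · exact ih j (by omega)
    rcases Nat.lt_or_ge j (2 * (l + 1) + 2) with h' | h'
    · obtain rfl : j = 2 * (l + 1) + 1 := by omega
      simpa [key.1] using hα
    · obtain rfl : j = 2 * (l + 1) + 2 := by omega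
      have := ha (2 * (l + 1) + 1)
      rwa [← this x ⊤ hxb le_top (by omega), key.2] at this

end Counting

/-! ### The number of atoms below a proper element. -/

section Atoms

variable {P : Type*} [Fintype P] [PartialOrder P] [BoundedOrder P] [GradeMinOrder ℕ P]

theorem mem_atoms {y p : P} : p ∈ layer ⊥ y 1 ↔ p ≤ y ∧ grade ℕ p = 1 := by
  have hb : grade ℕ (⊥ : P) = 0 := grade_bot
  simp [mem_layer, hb]

theorem ne_bot_of_grade_pos {p : P} (h : 0 < grade ℕ p) : p ≠ ⊥ := by
  rintro rfl
  rw [grade_bot, Nat.bot_eq_zero] at h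
  omega

/-- In $[p,\hat 1]$ the atoms $e,e'$ have a common upper cover $f$, of rank 3. It has only two
atoms, so $e$, $e'$ and $f$ all have the same ones. -/
theorem atoms_eq_of_grade_two (h2 : ∀ x y : P, x ≤ y → grade ℕ y = grade ℕ x + 2 →
    (layer x y 1).card = 2) {N : ℕ} (hrank : grade ℕ (⊤ : P) = N + 1) (hE : ExistsJoin P N)
    (h3 : ∀ y : P, grade ℕ y = 3 → (layer ⊥ y 1).card = 2) {p e e' : P} (hp : grade ℕ p = 1)
    (he : grade ℕ e = 2) (he' : grade ℕ e' = 2) (hpe : p ≤ e) (hpe' : p ≤ e') :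
    layer ⊥ e 1 = layer ⊥ e' 1 := by
  have hb : grade ℕ (⊥ : P) = 0 := grade_bot
  by_cases hne : e = e'
  · rw [hne]
  obtain ⟨f, hf, hef, hef'⟩ := hE p ⊤ (ne_bot_of_grade_pos (by omega)) le_top (by omega) e
    (mem_layer.2 ⟨hpe, le_top, by omega⟩) e' (mem_layer.2 ⟨hpe', le_top, by omega⟩) hne
  have hf3 := h3 f (by have := (mem_layer.1 hf).2.2; omega)
  have key : ∀ e, grade ℕ e = 2 → e ≤ f → layer ⊥ e 1 = layer ⊥ f 1 := fun e he hef =>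
    Finset.eq_of_subset_of_card_le (layer_mono_right 1 hef)
      (by rw [hf3, h2 ⊥ e bot_le (by omega)])
  rw [key e he hef, key e' he' hef']

theorem two_dvd_card_atoms (h2 : ∀ x y : P, x ≤ y → grade ℕ y = grade ℕ x + 2 →
    (layer x y 1).card = 2) {y : P} (hy : 2 ≤ grade ℕ y)
    (heq : ∀ p e e' : P, grade ℕ p = 1 → grade ℕ e = 2 → grade ℕ e' = 2 → p ≤ e → p ≤ e' →
      layer ⊥ e 1 = layer ⊥ e' 1) : 2 ∣ (layer ⊥ y 1).card := by
  have hb : grade ℕ (⊥ : P) = 0 := grade_bot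
  have hex : ∀ p ∈ layer ⊥ y 1, ∃ e, p ≤ e ∧ e ≤ y ∧ grade ℕ e = 2 := by
    intro p hp
    rw [mem_atoms] at hp
    have hlt : p < y := lt_of_le_of_ne hp.1 (by rintro rfl; omega)
    obtain ⟨e, he⟩ := layer_one_nonempty hlt
    rw [mem_layer] at he
    exact ⟨e, he.1, he.2.1, by omega⟩
  choose! e hpe hey he2 using hex
  refine dvd_card_of_classes (f := fun p => layer ⊥ (e p) 1) ?_ ?_ ?_ ?_
  · intro p hp
    exact h2 ⊥ (e p) bot_le (by rw [he2 p hp, hb])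
  · intro p hp
    exact mem_layer_cut hp (hpe p hp)
  · intro p hp
    exact layer_mono_right 1 (hey p hp)
  · intro p hp q hq
    have hqy := layer_mono_right 1 (hey p hp) hq
    rw [mem_atoms] at hq
    exact heq q _ _ hq.2 (he2 q hqy) (he2 p hp) (hpe q hqy) hq.1

/-- With $A$ atoms and $V$ coatoms, double counting gives $2\beta V=A(l+2)$ and the Euler relation
gives $4+Al=2V$. For $\beta\ge 2$ these yield $8+Al\le 2A$, impossible once $l\ge 3$ but not for
$l=1$, hence the separate hypothesis `hβ1`. For $\beta=1$ they give $A=2$. -/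
theorem IsEulerian.card_atoms_of_even (hE : IsEulerian P) {l β : ℕ} (hl : Odd l) (hβ : 0 < β)
    (ha : ∀ j ≤ l + 2, AtomCount P j j)
    (hd : ∀ j, 2 ≤ j → j ≤ l + 1 → ∀ z : P, grade ℕ z = j → (layer ⊥ z 1).card = 2)
    (hdβ : ∀ z : P, grade ℕ z = l + 2 → (layer ⊥ z 1).card = β * 2) (hβ1 : l = 1 → β = 1)
    {y : P} (hr : grade ℕ y = l + 3) : β = 1 ∧ (layer ⊥ y 1).card = 2 := by
  have hb : grade ℕ (⊥ : P) = 0 := grade_bot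
  have hw : ∀ j ≤ l + 2, ∀ p ∈ layer ⊥ y 1, (layer p y j).card = (l + 2).choose j :=
    fun j hj p hp => card_layer_eq_choose ha le_rfl hj
      (ne_bot_of_grade_pos (by rw [(mem_atoms.1 hp).2]; omega)) (mem_atoms.1 hp).1
      (by rw [hr, (mem_atoms.1 hp).2]; ring)
  set A := (layer ⊥ y 1).card with hA
  have hV : ∀ i < l, (layer ⊥ y (i + 2)).card * 2 = A * (l + 2).choose (i + 1) := fun i hi =>
    card_layer_succ_mul (fun z hz => hd (i + 2) (by omega) (by omega) z
      (by have := (mem_layer.1 hz).2.2; omega)) (hw (i + 1) (by omega))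
  have hV' : (layer ⊥ y (l + 2)).card * (β * 2) = A * (l + 2) := by
    have := card_layer_succ_mul (x := ⊥) (y := y) (j := l + 1) (c := β * 2)
      (fun z hz => hdβ z (by have := (mem_layer.1 hz).2.2; omega)) (hw (l + 1) (by omega))
    rwa [Nat.choose_succ_self_right] at this
  have hsum := hE.sum_card_middle_layers hl bot_le (hr.trans (by rw [hb]; ring))
  have hS : (∑ i ∈ Finset.range l, (-1 : ℤ) ^ i * (layer ⊥ y (i + 2)).card) * 2 =
      A * (l + 2) := by
    rw [← alternating_sum_middle_choose' l hl, Finset.sum_mul, Finset.mul_sum]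
    refine Finset.sum_congr rfl fun i hi => ?_
    have := hV i (Finset.mem_range.1 hi)
    zify at this
    rw [mul_assoc, this]
    ring
  rw [← hA] at hsum
  set V := (layer ⊥ y (l + 2)).card
  have h1 : 4 + (A : ℤ) * (l + 2) = 2 * A + 2 * V := by linarith
  zify at hV'
  have hβ' : β = 1 := by
    by_contra hne
    have h3 : (3 : ℤ) ≤ l := by
      obtain ⟨t, rfl⟩ := hl
      have : t ≠ 0 := by
        rintro rfl
        exact hne (hβ1 rfl)
      exact_mod_cast (by omega : 3 ≤ 2 * t + 1)
    have h2 : (2 : ℤ) ≤ β := by exact_mod_cast (by omega : 2 ≤ β)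
    have h4 : (V : ℤ) * 2 ≤ V * β := mul_le_mul_of_nonneg_left h2 (by positivity)
    have h5 : (A : ℤ) * 3 ≤ A * l := mul_le_mul_of_nonneg_left h3 (by positivity)
    linarith
  refine ⟨hβ', ?_⟩
  subst hβ'
  zify
  push_cast at hV'
  linarith

theorem IsEulerian.card_atoms_eq_two (hE : IsEulerian P) {N : ℕ} (hN : 3 ≤ N)
    (hrank : grade ℕ (⊤ : P) = N + 1) (ha : ∀ j ≤ N, AtomCount P j j)
    {d : ℕ → ℕ} (hd : ∀ n, ∀ y : P, grade ℕ y = n + 1 → (layer ⊥ y 1).card = d (n + 1))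
    (h3 : ∀ y : P, grade ℕ y = 3 → (layer ⊥ y 1).card = 2) (k : ℕ) (hk : 2 * k ≤ N) :
    ∀ j, 2 ≤ j → j ≤ 2 * k → ∀ z : P, grade ℕ z = j → (layer ⊥ z 1).card = 2 := by
  have hb : grade ℕ (⊥ : P) = 0 := grade_bot
  have h2 : ∀ x y : P, x ≤ y → grade ℕ y = grade ℕ x + 2 → (layer x y 1).card = 2 :=
    fun x y => hE.card_layer_one
  induction k with
  | zero => intros; omega
  | succ k ih =>
    replace ih := ih (by omega)
    rcases Nat.eq_zero_or_pos k with rfl | hk0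
    · intro j hj hj' z hz
      exact h2 ⊥ z bot_le (by omega)
    obtain ⟨l, rfl⟩ := Nat.exists_eq_add_of_le' hk0
    obtain ⟨y, hy⟩ := exists_grade_eq (P := P) (k := 2 * l + 4) (by omega)
    obtain ⟨z, hz⟩ := exists_grade_eq (P := P) (k := 2 * l + 3) (by omega)
    obtain ⟨M, rfl⟩ := Nat.exists_eq_add_of_le' (show 2 ≤ N by omega)
    have hJ := (uniqueJoin_and_existsJoin h2 ha M le_rfl).2
    obtain ⟨β, hβ⟩ := two_dvd_card_atoms h2 (y := z) (by omega)
      fun p e e' hp he he' hpe hpe' => atoms_eq_of_grade_two h2 hrank hJ h3 hp he he' hpe hpe'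
    have hdz : ∀ w : P, grade ℕ w = 2 * l + 3 → (layer ⊥ w 1).card = β * 2 := fun w hw => by
      rw [hd (2 * l + 2) w hw, ← hd (2 * l + 2) z hz, hβ, mul_comm]
    have hβ0 : 0 < β := by
      have := (layer_one_nonempty (bot_lt_iff_ne_bot.2 (ne_bot_of_grade_pos (p := z)
        (by omega)))).card_pos
      omega
    have key := hE.card_atoms_of_even (l := 2 * l + 1) (β := β) (by simp) hβ0
      (fun j hj => ha j (by omega)) ih hdz (fun h => by
        have := h3 z (by omega)
        omega) hy
    intro j hj hj' w hw
    rcases Nat.lt_or_ge j (2 * l + 3) with h | h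
    · exact ih j hj (by omega) w hw
    rcases Nat.lt_or_ge j (2 * l + 4) with h' | h'
    · rw [hdz w (by omega), key.1]
    · rw [hd (2 * l + 3) w (by omega), ← hd (2 * l + 3) y hy, key.2]

end Atoms

/-! ### Upper intervals of atoms are boolean. -/

section Boolean

variable {P : Type*} [Fintype P] [PartialOrder P] [BoundedOrder P] [GradeMinOrder ℕ P]

/-- Induction replaces $x$ by an atom $p$ of $[x,z]$. An atom $e$ of $[p,z]$ covers a second atom
$q$ of $[x,z]$; as $p,q\le w$ they have a common upper cover below $w$, which is $e$ by uniqueness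
in $[x,\hat 1]$. -/
theorem le_of_forall_atom_le (h2 : ∀ x y : P, x ≤ y → grade ℕ y = grade ℕ x + 2 →
    (layer x y 1).card = 2) {N : ℕ} (ha : ∀ n ≤ N, AtomCount P n n)
    (hrank : grade ℕ (⊤ : P) = N + 1) (k : ℕ) {x z w : P} (hx : x ≠ ⊥) (hxz : x ≤ z) (hxw : x ≤ w)
    (hr : grade ℕ z = grade ℕ x + k) (h : ∀ p ∈ layer x z 1, p ≤ w) : z ≤ w := by
  induction k generalizing x with
  | zero => exact eq_of_le_of_grade_le hxz (by omega) ▸ hxw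
  | succ k ih =>
    have hlt : x < z := lt_of_le_of_ne hxz (by rintro rfl; omega)
    obtain ⟨p, hp⟩ := layer_one_nonempty hlt
    have hpm := mem_layer.1 hp
    refine ih (ne_bot_of_le_of_ne_bot hx hpm.1) hpm.2.1 (h p hp) (by omega) fun e he => ?_
    have he2 := mem_layer_trans hp he
    have hem := mem_layer.1 he2
    obtain ⟨q, hq, hqp, -⟩ := exists_other_atom h2 hem.2.2 (mem_layer_right hp he)
    have hqz := layer_mono_right 1 hem.2.1 hq
    have hpw := mem_layer_cut hp (h p hp)
    have hqw := mem_layer_cut hqz (h q hqz)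
    have hxpos : 0 < grade ℕ x := by
      have := grade_strictMono (𝕆 := ℕ) (bot_lt_iff_ne_bot.2 hx)
      omega
    have hupper : ∀ v : P, x ≤ v → 2 ≤ grade ℕ v - grade ℕ x →
        ∃ n, grade ℕ v = grade ℕ x + (n + 2) ∧ n + 2 ≤ N := fun v hv hge => by
      have := grade_le_grade_of_le (le_top : v ≤ ⊤)
      exact ⟨grade ℕ v - grade ℕ x - 2, by omega, by omega⟩
    have hw2 : 2 ≤ grade ℕ w - grade ℕ x := by
      have hlt : p < w := by
        refine lt_of_le_of_ne (h p hp) ?_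
        rintro rfl
        exact hqp (eq_of_le_of_grade_le (mem_layer.1 hqw).2.1
          (by have := (mem_layer.1 hqw).2.2; omega))
      have := grade_strictMono (𝕆 := ℕ) hlt
      omega
    have ht2 : 2 ≤ grade ℕ (⊤ : P) - grade ℕ x := by
      have := grade_le_grade_of_le (le_top : w ≤ ⊤)
      omega
    obtain ⟨n, hn, hnN⟩ := hupper w hxw hw2
    obtain ⟨e', he', hpe', hqe'⟩ :=
      (uniqueJoin_and_existsJoin h2 ha n hnN).2 x w hx hxw hn p hpw q hqw hqp.symm
    obtain ⟨n', hn', hnN'⟩ := hupper ⊤ le_top ht2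
    have := (uniqueJoin_and_existsJoin h2 ha n' hnN').1 x ⊤ hx le_top hn'
      p (layer_mono_right 1 le_top hp) q (layer_mono_right 1 le_top hqz) hqp.symm
      e (layer_mono_right 2 le_top he2) e' (layer_mono_right 2 le_top he')
      (mem_layer.1 he).1 (mem_layer.1 hq).2.1 hpe' hqe'
    exact this ▸ (mem_layer.1 he').2.1

/-- The upper interval of an atom is a boolean lattice. -/
theorem nonempty_orderIso_finset (h2 : ∀ x y : P, x ≤ y → grade ℕ y = grade ℕ x + 2 →
    (layer x y 1).card = 2) {N : ℕ} (ha : ∀ n ≤ N, AtomCount P n n)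
    (hrank : grade ℕ (⊤ : P) = N + 1) {x : P} (hx : grade ℕ x = 1) :
    Nonempty (Set.Ici x ≃o Finset (Fin N)) := by
  classical
  have hxb : x ≠ ⊥ := ne_bot_of_grade_pos (by omega)
  have htop : grade ℕ (⊤ : P) = grade ℕ x + N := by omega
  have hle : ∀ z w : P, x ≤ z → x ≤ w → (layer x z 1 ⊆ layer x w 1 ↔ z ≤ w) := by
    intro z w hz hw
    refine ⟨fun h => ?_, layer_mono_right 1⟩
    have := grade_le_grade_of_le hz
    exact le_of_forall_atom_le h2 ha hrank (grade ℕ z - grade ℕ x) hxb hz hw (by omega)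
      fun p hp => (mem_layer.1 (h hp)).2.1
  have hcard : Fintype.card (layer x ⊤ 1) = N := by
    rw [Fintype.card_coe, ha N le_rfl x ⊤ hxb le_top htop]
  let ε : layer x ⊤ 1 ≃ Fin N := Fintype.equivFinOfCardEq hcard
  have hsurj : ∀ s ⊆ layer x ⊤ 1, ∃ z, x ≤ z ∧ layer x z 1 = s := by
    intro s hs
    have hsN : s.card ≤ N := by
      rw [← ha N le_rfl x ⊤ hxb le_top htop]
      exact Finset.card_le_card hs
    -- Surjectivity by counting: sending $z$ to its atoms is injective, and level $k$ has $\binom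
    -- Nk$ elements, as many as there are $k$-sets of atoms.
    have himg : (layer x ⊤ s.card).image (fun z => layer x z 1) =
        (layer x ⊤ 1).powersetCard s.card := by
      refine Finset.eq_of_subset_of_card_le ?_ ?_
      · intro t ht
        obtain ⟨z, hz, rfl⟩ := Finset.mem_image.1 ht
        rw [mem_layer] at hz
        exact Finset.mem_powersetCard.2 ⟨layer_mono_right 1 le_top,
          ha s.card hsN x z hxb hz.1 hz.2.2⟩
      · rw [Finset.card_powersetCard, ha N le_rfl x ⊤ hxb le_top htop,
          Finset.card_image_of_injOn, card_layer_eq_choose ha le_rfl hsN hxb le_top htop]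
        intro z hz w hw hzw
        have hz := (mem_layer.1 (Finset.mem_coe.1 hz)).1
        have hw := (mem_layer.1 (Finset.mem_coe.1 hw)).1
        have hzw : layer x z 1 = layer x w 1 := hzw
        exact le_antisymm ((hle z w hz hw).1 hzw.subset) ((hle w z hw hz).1 hzw.superset)
    have : s ∈ (layer x ⊤ s.card).image (fun z => layer x z 1) := by
      rw [himg]
      exact Finset.mem_powersetCard.2 ⟨hs, rfl⟩
    obtain ⟨z, hz, hzs⟩ := Finset.mem_image.1 this
    exact ⟨z, (mem_layer.1 hz).1, hzs⟩
  let f : Set.Ici x → Finset (Fin N) := fun z => {i | ((ε.symm i : layer x ⊤ 1) : P) ≤ z}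
  have hf : ∀ (z : Set.Ici x) (p : layer x ⊤ 1), ε p ∈ f z ↔ (p : P) ∈ layer x z 1 := by
    intro z p
    simp only [f, Finset.mem_filter, Finset.mem_univ, true_and, Equiv.symm_apply_apply]
    exact ⟨fun h => mem_layer_cut p.2 h, fun h => (mem_layer.1 h).2.1⟩
  have hfle : ∀ z w : Set.Ici x, f z ≤ f w ↔ z ≤ w := by
    intro z w
    rw [← Subtype.coe_le_coe, ← hle z w z.2 w.2]
    constructor
    · intro h p hp
      have hp' : p ∈ layer x ⊤ 1 := layer_mono_right 1 le_top hp
      exact (hf w ⟨p, hp'⟩).1 (h ((hf z ⟨p, hp'⟩).2 hp))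
    · intro h i hi
      obtain ⟨p, rfl⟩ := ε.surjective i
      exact (hf w p).2 (h ((hf z p).1 hi))
  refine ⟨RelIso.ofSurjective (OrderEmbedding.ofMapLEIff f hfle) fun t => ?_⟩
  obtain ⟨z, hz, hzs⟩ := hsurj (t.image fun i => ((ε.symm i : layer x ⊤ 1) : P)) fun p hp => by
    obtain ⟨i, -, rfl⟩ := Finset.mem_image.1 hp
    exact (ε.symm i).2
  refine ⟨⟨z, hz⟩, ?_⟩
  ext i
  obtain ⟨p, rfl⟩ := ε.surjective i
  change ε p ∈ f ⟨z, hz⟩ ↔ _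
  rw [hf]
  change (p : P) ∈ layer x z 1 ↔ _
  rw [hzs, Finset.mem_image]
  constructor
  · rintro ⟨i, hi, hip⟩
    rw [← Subtype.ext hip, Equiv.apply_symm_apply]
    exact hi
  · intro h
    exact ⟨ε p, h, by simp⟩

end Boolean

/-! ### Assembling the poset from its components. -/

theorem nonempty_orderIso_withBot_withTop {P Y : Type*} [PartialOrder P] [BoundedOrder P]
    [PartialOrder Y] (hbt : (⊥ : P) ≠ ⊤) (g : Y → P) (hg : ∀ a b, g a ≤ g b ↔ a ≤ b)
    (hbot : ∀ a, g a ≠ ⊥) (htop : ∀ a, g a ≠ ⊤) (hsurj : ∀ z, z ≠ ⊥ → z ≠ ⊤ → ∃ a, g a = z) :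
    Nonempty (P ≃o WithBot (WithTop Y)) := by
  let G : WithBot (WithTop Y) → P := WithBot.recBotCoe ⊥ (WithTop.recTopCoe ⊤ g)
  have hG : ∀ a b, G a ≤ G b ↔ a ≤ b := by
    intro a b
    induction a using WithBot.recBotCoe with
    | bot => simp [G]
    | coe a =>
      induction b using WithBot.recBotCoe with
      | bot =>
        induction a using WithTop.recTopCoe with
        | top =>
          change (⊤ : P) ≤ ⊥ ↔ _
          simp [hbt.symm]
        | coe a => simp [G, hbot]
      | coe b =>
        induction b using WithTop.recTopCoe with
        | top =>
          change _ ≤ (⊤ : P) ↔ _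
          simp
        | coe b =>
          induction a using WithTop.recTopCoe with
          | top =>
            change (⊤ : P) ≤ g b ↔ _
            simp [htop]
          | coe a => simp [G, hg]
  refine ⟨(RelIso.ofSurjective (OrderEmbedding.ofMapLEIff G hG) fun z => ?_).symm⟩
  by_cases hzb : z = ⊥
  · exact ⟨⊥, hzb.symm⟩
  by_cases hzt : z = ⊤
  · exact ⟨((⊤ : WithTop Y) : WithBot (WithTop Y)), hzt.symm⟩
  obtain ⟨a, ha⟩ := hsurj z hzb hzt
  exact ⟨((a : WithTop Y) : WithBot (WithTop Y)), ha⟩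

namespace DualSuspension

variable {Q : Type*} [PartialOrder Q] [BoundedOrder Q]

theorem of_le_of {x y : Q} : of x ≤ of y ↔ x ≤ y := Iff.rfl

theorem of_le_new {x : Q} {i : Fin 2} : of x ≤ new i ↔ x = ⊥ := Iff.rfl

theorem new_le_of {i : Fin 2} {y : Q} : new i ≤ of y ↔ ⊥ < y := Iff.rfl

theorem isMin_of_bot : IsMin (of (⊥ : Q)) := by
  rintro (x | i) h
  · exact of_le_of.2 bot_le
  · exact absurd (new_le_of.1 h) (lt_irrefl _)

theorem isMax_of_top [Nontrivial Q] : IsMax (of (⊤ : Q)) := by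
  rintro (x | i) h
  · exact of_le_of.2 le_top
  · exact absurd (of_le_new.1 h) top_ne_bot

theorem not_isMin_of {x : Q} (h : x ≠ ⊥) : ¬ IsMin (of x) := fun hm =>
  h (le_bot_iff.1 (of_le_of.1 (hm (of_le_of.2 (bot_le : ⊥ ≤ x)))))

theorem not_isMax_of {x : Q} (h : x ≠ ⊤) : ¬ IsMax (of x) := fun hm =>
  h (top_le_iff.1 (of_le_of.1 (hm (of_le_of.2 (le_top : x ≤ ⊤)))))

theorem not_isMin_new {i : Fin 2} : ¬ IsMin (new i : DualSuspension Q) := fun hm =>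
  absurd (new_le_of.1 (hm (of_le_new.2 (rfl : (⊥ : Q) = ⊥)))) (lt_irrefl _)

theorem not_isMax_new [Nontrivial Q] {i : Fin 2} : ¬ IsMax (new i : DualSuspension Q) := fun hm =>
  absurd (of_le_new.1 (hm (new_le_of.2 (bot_lt_top (α := Q))))) top_ne_bot

end DualSuspension

section Components

variable {P : Type*} [Fintype P] [PartialOrder P] [BoundedOrder P] [GradeMinOrder ℕ P]

/-- The proper elements all of whose atoms lie in the atom pair `{p, q}` form a proper part of a
dual suspension of the upper interval `[p, ⊤]`. -/
theorem exists_component {Q : Type*} [PartialOrder Q] [BoundedOrder Q] [Nontrivial Q] {A : Finset P}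
    (hA2 : A.card = 2) (hA1 : ∀ p ∈ A, grade ℕ p = 1) (htop : 2 ≤ grade ℕ (⊤ : P))
    (hψ : ∀ p ∈ A, Nonempty (Set.Ici p ≃o Q))
    (hA : ∀ p ∈ A, ∀ z, p < z → z ≠ ⊤ → layer ⊥ z 1 = A) :
    ∃ h : {x : DualSuspension Q // ¬ IsMin x ∧ ¬ IsMax x} → P,
      (∀ x y, h x ≤ h y ↔ x ≤ y) ∧ (∀ x, layer ⊥ (h x) 1 ⊆ A ∧ h x ≠ ⊥ ∧ h x ≠ ⊤) ∧
      ∀ z, z ≠ ⊥ → z ≠ ⊤ → layer ⊥ z 1 ⊆ A → ∃ x, h x = z := by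
  classical
  obtain ⟨p, q, hpq, rfl⟩ := Finset.card_eq_two.1 hA2
  have hpA : p ∈ ({p, q} : Finset P) := by simp
  have hqA : q ∈ ({p, q} : Finset P) := by simp
  have hp1 := hA1 p hpA
  have hq1 := hA1 q hqA
  obtain ⟨ψ⟩ := hψ p hpA
  let a : Fin 2 → P := ![p, q]
  have haA : ∀ i, a i ∈ ({p, q} : Finset P) := by
    intro i
    fin_cases i
    · exact hpA
    · exact hqA
  have ha1 : ∀ i, grade ℕ (a i) = 1 := fun i => hA1 _ (haA i)
  have hainj : ∀ i j, a i ≤ a j ↔ i = j := by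
    intro i j
    refine ⟨fun h => ?_, fun h => h ▸ le_rfl⟩
    have h := eq_of_le_of_grade_le h (by rw [ha1, ha1])
    fin_cases i <;> fin_cases j
    · rfl
    · exact absurd h hpq
    · exact absurd h.symm hpq
    · rfl
  -- The new elements go to the two atoms. The value at `.of ⊥` is $p$ rather than $\hat 0$, which
  -- is harmless because only elements that are neither minimal nor maximal are used.
  let H : DualSuspension Q → P
    | .of S => ψ.symm S
    | .new i => a i
  have hψbot : ψ ⟨p, le_rfl⟩ = ⊥ := by
    refine le_bot_iff.1 ?_
    rw [← ψ.apply_symm_apply ⊥, ψ.le_iff_le]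
    exact (ψ.symm ⊥).2
  have hψtop : ψ ⟨⊤, le_top⟩ = ⊤ := by
    refine top_le_iff.1 ?_
    rw [← ψ.apply_symm_apply ⊤, ψ.le_iff_le]
    exact Subtype.coe_le_coe.1 le_top
  have hbot : ∀ S : Q, S ≠ ⊥ → p < ψ.symm S := by
    intro S hS
    refine lt_of_le_of_ne (ψ.symm S).2 fun h => hS ?_
    have : (⟨p, le_rfl⟩ : Set.Ici p) = ψ.symm S := Subtype.ext h
    rw [← hψbot, this, ψ.apply_symm_apply]
  have htop' : ∀ S : Q, S ≠ ⊤ → (ψ.symm S : P) ≠ ⊤ := by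
    intro S hS h
    have : ψ.symm S = ⟨⊤, le_top⟩ := Subtype.ext h
    rw [← this, ψ.apply_symm_apply] at hψtop
    exact hS hψtop
  have hproper : ∀ x : {x : DualSuspension Q // ¬ IsMin x ∧ ¬ IsMax x}, ∀ S, x.1 = .of S →
      S ≠ ⊥ ∧ S ≠ ⊤ := by
    rintro ⟨x, hx⟩ S rfl
    refine ⟨?_, ?_⟩
    · rintro rfl
      exact hx.1 DualSuspension.isMin_of_bot
    · rintro rfl
      exact hx.2 DualSuspension.isMax_of_top
  have hatoms : ∀ S : Q, S ≠ ⊥ → S ≠ ⊤ → layer ⊥ (ψ.symm S : P) 1 = {p, q} := fun S hS hS' =>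
    hA p hpA _ (hbot S hS) (htop' S hS')
  refine ⟨fun x => H x.1, ?_, ?_, ?_⟩
  · rintro ⟨x, hx⟩ ⟨y, hy⟩
    rw [← Subtype.coe_le_coe]
    rcases x with S | i <;> rcases y with T | j
    · change (ψ.symm S : P) ≤ ψ.symm T ↔ S ≤ T
      rw [Subtype.coe_le_coe, ψ.symm.le_iff_le]
    · have hS := hproper ⟨_, hx⟩ S rfl
      change (ψ.symm S : P) ≤ a j ↔ S = ⊥
      refine ⟨fun h => ?_, fun h => absurd h hS.1⟩
      have h1 := grade_le_grade_of_le h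
      have h3 := grade_strictMono (𝕆 := ℕ) (hbot S hS.1)
      have h4 := ha1 j
      omega
    · have hT := hproper ⟨_, hy⟩ T rfl
      change a i ≤ (ψ.symm T : P) ↔ ⊥ < T
      refine ⟨fun _ => bot_lt_iff_ne_bot.2 hT.1, fun _ => ?_⟩
      have := haA i
      rw [← hatoms T hT.1 hT.2, mem_atoms] at this
      exact this.1
    · exact hainj i j
  · rintro ⟨S | i, hx⟩
    · have hS := hproper ⟨_, hx⟩ S rfl
      exact ⟨(hatoms S hS.1 hS.2).subset, ne_bot_of_le_of_ne_bot
        (ne_bot_of_grade_pos (by omega)) (hbot S hS.1).le, htop' S hS.2⟩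
    · change layer ⊥ (a i) 1 ⊆ {p, q} ∧ a i ≠ ⊥ ∧ a i ≠ ⊤
      have h1 := ha1 i
      refine ⟨fun r hr => ?_, ne_bot_of_grade_pos (by omega), fun h => ?_⟩
      · rw [mem_atoms] at hr
        rw [eq_of_le_of_grade_le hr.1 (by omega)]
        exact haA i
      · rw [h] at h1
        omega
  · intro z hzb hzt hz
    obtain ⟨r, hr⟩ := layer_one_nonempty (bot_lt_iff_ne_bot.2 hzb)
    have hrA := hz hr
    have hrz := (mem_atoms.1 hr).1
    by_cases hrz' : r = z
    · have : ∃ i, a i = z := by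
        rw [hrz'] at hrA
        rw [Finset.mem_insert, Finset.mem_singleton] at hrA
        rcases hrA with rfl | rfl
        · exact ⟨0, rfl⟩
        · exact ⟨1, rfl⟩
      obtain ⟨i, hi⟩ := this
      exact ⟨⟨.new i, DualSuspension.not_isMin_new, DualSuspension.not_isMax_new⟩, hi⟩
    have hzA := hA r hrA z (lt_of_le_of_ne hrz hrz') hzt
    have hpz : p ≤ z := (mem_atoms.1 (hzA ▸ hpA)).1
    have hqz : q ≤ z := (mem_atoms.1 (hzA ▸ hqA)).1
    refine ⟨⟨.of (ψ ⟨z, hpz⟩), DualSuspension.not_isMin_of fun h => ?_,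
      DualSuspension.not_isMax_of fun h => ?_⟩, ?_⟩
    · rw [← hψbot] at h
      obtain rfl : z = p := congrArg Subtype.val (ψ.injective h)
      exact hpq (eq_of_le_of_grade_le hqz (by omega)).symm
    · rw [← hψtop] at h
      exact hzt (congrArg Subtype.val (ψ.injective h))
    · change (ψ.symm (ψ ⟨z, hpz⟩) : P) = z
      rw [ψ.symm_apply_apply]

/-- A poset whose proper elements above a common atom have the same pair of atoms, and whose
atoms have upper intervals isomorphic to `Q`, is an `α`-summation of dual suspensions of `Q`. -/
theorem exists_orderIso_kSummation {Q : Type*} [PartialOrder Q] [BoundedOrder Q] [Nontrivial Q]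
    (htop : 3 ≤ grade ℕ (⊤ : P)) (hψ : ∀ p : P, grade ℕ p = 1 → Nonempty (Set.Ici p ≃o Q))
    (hcard : ∀ z : P, 2 ≤ grade ℕ z → z ≠ ⊤ → (layer ⊥ z 1).card = 2)
    (heq : ∀ p z w : P, grade ℕ p = 1 → p < z → p < w → z ≠ ⊤ → w ≠ ⊤ →
      layer ⊥ z 1 = layer ⊥ w 1) :
    ∃ α : ℕ, 1 ≤ α ∧ Nonempty (P ≃o KSummation α (DualSuspension Q)) := by
  classical
  have hlt2 : ∀ p z : P, grade ℕ p = 1 → p < z → 2 ≤ grade ℕ z := fun p z hp hz => by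
    have := grade_strictMono (𝕆 := ℕ) hz
    omega
  have hne : ∀ z : P, grade ℕ z = 2 → z ≠ ⊤ := by
    rintro z hz rfl
    omega
  -- The atom pairs of rank-2 elements index the components, so $\alpha$ is their number; by `heq`
  -- distinct pairs are disjoint.
  let 𝒜 : Finset (Finset P) := (Finset.univ.filter fun e : P => grade ℕ e = 2).image
    fun e => layer ⊥ e 1
  have h𝒜 : ∀ A ∈ 𝒜, ∃ e : P, grade ℕ e = 2 ∧ layer ⊥ e 1 = A := fun A hA => by
    simpa [𝒜] using hA
  have hmem : ∀ e : P, grade ℕ e = 2 → layer ⊥ e 1 ∈ 𝒜 := fun e he =>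
    Finset.mem_image_of_mem _ (by simpa using he)
  have hex : ∀ p : P, grade ℕ p = 1 → ∃ e, p < e ∧ grade ℕ e = 2 := by
    intro p hp
    have hlt : p < ⊤ := lt_top_iff_ne_top.2 (by rintro rfl; omega)
    obtain ⟨e, he⟩ := layer_one_nonempty hlt
    exact ⟨e, lt_of_mem_layer_succ (j := 0) he, by have := (mem_layer.1 he).2.2; omega⟩
  have hlt1 : ∀ p e : P, p ∈ layer ⊥ e 1 → grade ℕ e = 2 → p < e := by
    intro p e hp he
    rw [mem_atoms] at hp
    exact lt_of_le_of_ne hp.1 (by rintro rfl; omega)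
  have hcomp : ∀ A : 𝒜, ∃ h : {x : DualSuspension Q // ¬ IsMin x ∧ ¬ IsMax x} → P,
      (∀ x y, h x ≤ h y ↔ x ≤ y) ∧ (∀ x, layer ⊥ (h x) 1 ⊆ A.1 ∧ h x ≠ ⊥ ∧ h x ≠ ⊤) ∧
      ∀ z, z ≠ ⊥ → z ≠ ⊤ → layer ⊥ z 1 ⊆ A.1 → ∃ x, h x = z := by
    rintro ⟨A, hA⟩
    obtain ⟨e, he, rfl⟩ := h𝒜 A hA
    exact exists_component (hcard e he.ge (hne e he)) (fun p hp => (mem_atoms.1 hp).2)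
      (by omega) (fun p hp => hψ p (mem_atoms.1 hp).2)
      fun p hp z hpz hz => heq p z e (mem_atoms.1 hp).2 hpz (hlt1 p e hp he) hz (hne e he)
  choose h hle hsub hsurj using hcomp
  have hdisj : ∀ A B : 𝒜, ∀ p, p ∈ A.1 → p ∈ B.1 → A = B := by
    rintro ⟨A, hA⟩ ⟨B, hB⟩ p hpA hpB
    obtain ⟨e, he, rfl⟩ := h𝒜 A hA
    obtain ⟨f, hf, rfl⟩ := h𝒜 B hB
    exact Subtype.ext (heq p e f (mem_atoms.1 hpA).2 (hlt1 p e hpA he) (hlt1 p f hpB hf)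
      (hne e he) (hne f hf))
  let ε : Fin 𝒜.card ≃ 𝒜 := 𝒜.equivFin.symm
  refine ⟨𝒜.card, ?_, ?_⟩
  · obtain ⟨e, he⟩ := exists_grade_eq (P := P) (k := 2) (by omega)
    exact Finset.card_pos.2 ⟨_, hmem e he⟩
  refine nonempty_orderIso_withBot_withTop ?_ (fun x => h (ε x.1) x.2) ?_ ?_ ?_ ?_
  · intro hbt
    rw [← hbt, grade_bot, Nat.bot_eq_zero] at htop
    omega
  · rintro ⟨i, x⟩ ⟨j, y⟩
    constructor
    · intro hxy
      have hxy : h (ε i) x ≤ h (ε j) y := hxy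
      have hij : i = j := by
        obtain ⟨p, hp⟩ := layer_one_nonempty (bot_lt_iff_ne_bot.2 (hsub (ε i) x).2.1)
        exact ε.injective (hdisj _ _ p ((hsub (ε i) x).1 hp)
          ((hsub (ε j) y).1 (layer_mono_right 1 hxy hp)))
      subst hij
      exact Sigma.mk_le_mk_iff.2 ((hle _ _ _).1 hxy)
    · rintro ⟨_, _, _, hxy⟩
      exact (hle _ _ _).2 hxy
  · exact fun x => (hsub _ _).2.1
  · exact fun x => (hsub _ _).2.2
  · intro z hzb hzt
    obtain ⟨p, hp⟩ := layer_one_nonempty (bot_lt_iff_ne_bot.2 hzb)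
    have hp1 := (mem_atoms.1 hp).2
    obtain ⟨e, hpe, he⟩ := hex p hp1
    have hzA : layer ⊥ z 1 ⊆ layer ⊥ e 1 := by
      by_cases hpz : p = z
      · intro r hr
        rw [← hpz, mem_atoms] at hr
        rw [eq_of_le_of_grade_le hr.1 (by omega)]
        exact mem_layer_cut hp hpe.le
      · exact (heq p z e hp1 (lt_of_le_of_ne (mem_atoms.1 hp).1 hpz) hpe hzt (hne e he)).subset
    obtain ⟨x, hx⟩ := hsurj ⟨_, hmem e he⟩ z hzb hzt hzA
    refine ⟨⟨ε.symm ⟨_, hmem e he⟩, x⟩, ?_⟩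
    simpa using hx

end Components

end EulerianSheffer

theorem mainTheorem5 {P : Type*} [Finite P] [PartialOrder P] [BoundedOrder P]
    [GradeMinOrder ℕ P]
    (hEulerian : EulerianSheffer.IsEulerian P)
    (hSheffer : EulerianSheffer.IsSheffer P)
    (B D : ℕ → ℕ)
    (hB : EulerianSheffer.IsBinomialFactorialFunction P B)
    (hD : EulerianSheffer.IsShefferFactorialFunction P D)
    (m : ℕ) (hrank : grade ℕ (⊤ : P) = 2 * m + 1) (hm : 5 ≤ 2 * m + 1)
    (hB3 : B 3 = 6) (hD3 : D 3 = 4) :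
    ∃ α : ℕ, 1 ≤ α ∧
      Nonempty (P ≃o EulerianSheffer.KSummation α
        (EulerianSheffer.DualSuspension (EulerianSheffer.BooleanLattice (2 * m)))) := by
  open EulerianSheffer in
  classical
  have := Fintype.ofFinite P
  have hb : grade ℕ (⊥ : P) = 0 := grade_bot
  have h2 : ∀ x y : P, x ≤ y → grade ℕ y = grade ℕ x + 2 → (layer x y 1).card = 2 :=
    fun x y => hEulerian.card_layer_one
  have ha : ∀ j ≤ 2 * m, AtomCount P j j :=
    hEulerian.atomCount_self (a := fun n => B n / B (n - 1)) hB.atomCount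
      (hEulerian.atomCount_three hB hB3) hrank m le_rfl
  have h3 : ∀ y : P, grade ℕ y = 3 → (layer ⊥ y 1).card = 2 := by
    intro y hy
    have h := hEulerian.numMaxChains_of_grade_three (bot_le : ⊥ ≤ y) (by omega)
    rw [hD 3 y hy, hD3] at h
    omega
  have hcard := hEulerian.card_atoms_eq_two (N := 2 * m) (by omega) hrank ha
    (d := fun n => D n / B (n - 1)) (fun n y => card_atoms_eq_div hB hD) h3 m le_rfl
  have hcard' : ∀ z : P, 2 ≤ grade ℕ z → z ≠ ⊤ → (layer ⊥ z 1).card = 2 := fun z hz hzt => by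
    have := grade_strictMono (𝕆 := ℕ) (lt_top_iff_ne_top.2 hzt)
    exact hcard (grade ℕ z) hz (by omega) z rfl
  have hJ : ExistsJoin P (2 * m) := by
    have := (uniqueJoin_and_existsJoin h2 ha (2 * m - 2) (by omega)).2
    rwa [show 2 * m - 2 + 2 = 2 * m by omega] at this
  -- Supplies the nontriviality of the boolean lattice.
  have : Nonempty (Fin (2 * m)) := ⟨⟨0, by omega⟩⟩
  refine exists_orderIso_kSummation (by omega) (fun p hp => nonempty_orderIso_finset h2 ha hrank hp)
    hcard' ?_
  intro p z w hp hpz hpw hz hw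
  -- A proper $z>p$ has the same two atoms as any rank-2 element of $[p,z]$, which reduces the claim
  -- to rank 2.
  have hdown : ∀ z : P, p < z → z ≠ ⊤ → ∃ e, p ≤ e ∧ grade ℕ e = 2 ∧
      layer ⊥ e 1 = layer ⊥ z 1 := by
    intro z hpz hz
    obtain ⟨e, he⟩ := layer_one_nonempty hpz
    rw [mem_layer] at he
    have hz2 := grade_strictMono (𝕆 := ℕ) hpz
    refine ⟨e, he.1, by omega, Finset.eq_of_subset_of_card_le (layer_mono_right 1 he.2.1) ?_⟩
    rw [hcard' z (by omega) hz, h2 ⊥ e bot_le (by omega)]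
  obtain ⟨e, hpe, he, hez⟩ := hdown z hpz hz
  obtain ⟨f, hpf, hf, hfw⟩ := hdown w hpw hw
  rw [← hez, ← hfw]
  exact atoms_eq_of_grade_two h2 hrank hJ h3 hp he hf hpe hpf
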